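/- **Conventions.** Circuits are Boolean circuits whose gates have fan-in two and compute arbitrary binary Boolean operations; the size of a circuit is its number of gates (constants, input bits and random bits are free). A probabilistic circuit additionally reads uniformly random bits. A deterministic circuit with real-valued output in $[0,1]$ outputs bits $b_0,\dots,b_p$ (for any $p$), read as the number $\sum_{i} b_i2^{-i}$, which must be at most $1$ on every input. For a pair $(Y,Z)$ over $\{0,1\}^n\times\{0,1\}^m$ let $\widetilde H_\infty(Y|Z)=-\log_2\mathbb E_{z\leftarrow Z}\max_y\Pr[Y=y\mid Z=z]$. Write $(X,Z)\sim_{\varepsilon,s}(Y,Z)$ if $|\Pr[C(X,Z)=1]-\Pr[C(Y,Z)=1]|\le\varepsilon$ for all probabilistic circuits $C$ of size at most $s$ with one output bit. In what follows $(Y,Z)$ ranges over joint distributions over $\{0,1\}^n\times\{0,1\}^m$ with the given marginal $Z$. * $H^{\rm unp}_{\gamma,s}(X|Z)\ge k$: there is $(Y,Z)$ with $(X,Z)\sim_{\gamma,s}(Y,Z)$ such that $\Pr[C(Z)=Y]\le 2^{-k}$ for every probabilistic circuit $C$ of size at most $s$. * $H^{\rm HILL}_{\varepsilon,s}(X|Z)\ge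 k$: there is $(Y,Z)$ with $\widetilde H_\infty(Y|Z)\ge k$ and $(X,Z)\sim_{\varepsilon,s}(Y,Z)$. * $H^{\rm metric,det,[0,1]}_{\varepsilon,s}(X|Z)\ge k$: for every deterministic circuit $D$ of size at most $s$ with real-valued output in $[0,1]$ there is $(Y,Z)$ with $\widetilde H_\infty(Y|Z)\ge k$ and $|\mathbb E D(X,Z)-\mathbb E D(Y,Z)|\le\varepsilon$. **Theorem 2 (Unpredictability Entropy Implies HILL Entropy).** There are universal constants $c_1,c_2,c_3>0$ such that the following holds. Let $n,m,s\ge 0$ be integers, let $k,\gamma$ be real numbers, let $(X,Z)$ be a distribution over $\{0,1\}^n\times\{0,1\}^m$ with $H^{\rm unp}_{\gamma,s}(X|Z)\ge k$, let $\Delta=n-k$ be the entropy gap, and let $\varepsilon>0$ satisfy $2^{\Delta}/\varepsilon\ge 2$. Then $$H^{\rm metric,det,[0,1]}_{\varepsilon+\gamma,\,t}(X|Z)\ge k\qquad\text{for}\qquad t=c_1\cdot s\cdot\frac{\varepsilon^5}{2^{5\Delta}\log_2^2(2^\Delta\varepsilon^{-1})}.$$ Moreover, for every $\delta>0$, $$H^{\rm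 HILL}_{\varepsilon+\delta+\gamma,\;c_2\,t\delta^2/(n+m)}(X|Z)\ge k,$$ and, if $\gamma=\varepsilon$, $$H^{\rm HILL}_{3\varepsilon,\;c_3\,s\,\varepsilon^7/(2^{5\Delta}(n+m)\log_2^2(2^\Delta\varepsilon^{-1}))}(X|Z)\ge k.$$ (For $n=m=0$ the circuit sizes with the denominator $n+m$ are read as $0$.) -/

import Mathlib

namespace CompEntropy

/-- Bit strings of length `n`, i.e. `{0,1}^n`. -/
abbrev BitStr (n : ℕ) : Type := Fin n → Bool

/-! ### Boolean circuits -/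

/-- What a gate (or an output) of a circuit may be connected to: a constant, an input bit,
or one of `g` gates. -/
inductive Wire (ι : Type) (g : ℕ) : Type
  | const (b : Bool) : Wire ι g
  | input (i : ι) : Wire ι g
  | gate (j : Fin g) : Wire ι g

/-- The bit carried by a wire, given the input bits `x` and the values `v` of the gates. -/
def Wire.val {ι : Type} {g : ℕ} (x : ι → Bool) (v : Fin g → Bool) : Wire ι g → Bool
  | .const b => b
  | .input i => x i
  | .gate j => v j

/-- A sequence of `g` gates of fan-in two (all binary Boolean operations are allowed), each of
which is fed by constants, input bits and earlier gates. Fan-out is unbounded. -/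
inductive Netlist (ι : Type) : ℕ → Type
  | nil : Netlist ι 0
  | snoc {g : ℕ} (N : Netlist ι g) (op : Bool → Bool → Bool) (a b : Wire ι g) : Netlist ι (g + 1)

/-- The values of all gates on input `x`. -/
def Netlist.vals {ι : Type} (x : ι → Bool) : {g : ℕ} → Netlist ι g → Fin g → Bool
  | _, .nil => Fin.elim0
  | _, .snoc N op a b =>
      Fin.snoc (α := fun _ => Bool) (N.vals x) (op (a.val x (N.vals x)) (b.val x (N.vals x)))

/-- A (deterministic) circuit with input bits indexed by `ι` and `o` output bits.
Its size is its number of gates. -/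
structure Circuit (ι : Type) (o : ℕ) : Type where
  size : ℕ
  gates : Netlist ι size
  out : Fin o → Wire ι size

/-- The output of a circuit. -/
def Circuit.eval {ι : Type} {o : ℕ} (C : Circuit ι o) (x : ι → Bool) : BitStr o :=
  fun i => (C.out i).val x (C.gates.vals x)

/-- A probabilistic circuit: a circuit with additional input bits (coins), which are uniformly
random. -/
structure ProbCircuit (ι : Type) (o : ℕ) : Type where
  coins : ℕ
  circuit : Circuit (ι ⊕ Fin coins) o

/-- The size of a probabilistic circuit is its number of gates. -/
def ProbCircuit.size {ι : Type} {o : ℕ} (C : ProbCircuit ι o) : ℕ := C.circuit.size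

/-- The probability, over the coins, that `C` outputs `y` on input `x`. -/
noncomputable def ProbCircuit.prob {ι : Type} {o : ℕ} (C : ProbCircuit ι o) (x : ι → Bool)
    (y : BitStr o) : ℝ :=
  (∑ ω : BitStr C.coins, if C.circuit.eval (Sum.elim x ω) = y then (1 : ℝ) else 0) / 2 ^ C.coins

/-- The number with binary expansion `b₀.b₁b₂…bₚ` that a circuit with output bits
`b₀, b₁, …, bₚ` produces on input `x`. -/
noncomputable def Circuit.realVal {ι : Type} {p : ℕ} (C : Circuit ι (p + 1)) (x : ι → Bool) : ℝ :=
  ∑ i : Fin (p + 1), if C.eval x i then (1 / 2 : ℝ) ^ (i : ℕ) else 0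

/-! ### Distributions

A distribution of a pair `(X, Z)` over `{0,1}^n × {0,1}^m` is a real function `P` on
`BitStr n × BitStr m` with `P ∈ stdSimplex ℝ (BitStr n × BitStr m)`. -/

variable {n m : ℕ}

/-- The marginal law of `Z`. -/
noncomputable def margZ (P : BitStr n × BitStr m → ℝ) (z : BitStr m) : ℝ := ∑ x, P (x, z)

/-- The expectation of `f (X, Z)`. -/
noncomputable def expect (P f : BitStr n × BitStr m → ℝ) : ℝ := ∑ w, P w * f w

/-- The pair `(x, z)` as the input of a circuit. -/
def pairInput (w : BitStr n × BitStr m) : Fin n ⊕ Fin m → Bool := Sum.elim w.1 w.2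

/-- `Q` is the law of some pair `(Y, Z)` with the same `Z` as in the pair with law `P`. -/
def IsPairWithSameZ (P Q : BitStr n × BitStr m → ℝ) : Prop :=
  Q ∈ stdSimplex ℝ (BitStr n × BitStr m) ∧ ∀ z, margZ Q z = margZ P z

/-- The average min-entropy `-log₂ 𝔼_{z ← Z} max_x Pr[X = x | Z = z]`. -/
noncomputable def avgMinEntropy (P : BitStr n × BitStr m → ℝ) : ℝ :=
  -Real.logb 2 (∑ z, margZ P z * ⨆ x, P (x, z) / margZ P z)

/-- `(ε, s)`-indistinguishability: no probabilistic circuit of size at most `s` with Boolean output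
has distinguishing advantage more than `ε`. -/
def Indist (ε s : ℝ) (P Q : BitStr n × BitStr m → ℝ) : Prop :=
  ∀ C : ProbCircuit (Fin n ⊕ Fin m) 1, (C.size : ℝ) ≤ s →
    |expect P (fun w => C.prob (pairInput w) fun _ => true) -
      expect Q (fun w => C.prob (pairInput w) fun _ => true)| ≤ ε

/-- `X|Z` has unpredictability entropy at least `k` with quality `(γ, s)`. -/
def UnpEntropyGE (γ s : ℝ) (P : BitStr n × BitStr m → ℝ) (k : ℝ) : Prop :=
  ∃ Q, IsPairWithSameZ P Q ∧ Indist γ s P Q ∧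
    ∀ C : ProbCircuit (Fin m) n, (C.size : ℝ) ≤ s →
      expect Q (fun w => C.prob w.2 w.1) ≤ (2 : ℝ) ^ (-k)

/-- `X|Z` has HILL entropy at least `k` with quality `(ε, s)`. -/
def HILLEntropyGE (ε s : ℝ) (P : BitStr n × BitStr m → ℝ) (k : ℝ) : Prop :=
  ∃ Q, IsPairWithSameZ P Q ∧ k ≤ avgMinEntropy Q ∧ Indist ε s P Q

/-- `X|Z` has metric entropy at least `k` with quality `(ε, s)` against deterministic circuits
with real-valued output in `[0, 1]`. -/
def MetricEntropyDetRealGE (ε s : ℝ) (P : BitStr n × BitStr m → ℝ) (k : ℝ) : Prop :=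
  ∀ (p : ℕ) (D : Circuit (Fin n ⊕ Fin m) (p + 1)), (∀ x, D.realVal x ≤ 1) → (D.size : ℝ) ≤ s →
    ∃ Q, IsPairWithSameZ P Q ∧ k ≤ avgMinEntropy Q ∧
      |expect P (fun w => D.realVal (pairInput w)) -
        expect Q (fun w => D.realVal (pairInput w))| ≤ ε

end CompEntropy

/-! Metric entropy. Let `Q'` be the unpredictable law that is close to `P`, and let `D` be a test.
Up to small errors, the expectation of `D` under `Q'` must not exceed its maximum over the laws with
the given marginal `Z` and guessing probability at most `2^(-k)`. This maximum has a Lagrange dual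
with a single multiplier (`exists_multiplier`). The dual provides a number `M` and thresholds `τ z`
such that, for every `z`, the excess `(D(x,z) - τ z)⁺` averages to at most `M` over uniform `x`,
while the mean of `τ` plus `M 2^Δ` is at most the maximum, up to rounding (`exists_thresholds`). If
the claim failed, then under `Q'` the excess would have mean at least about `M 2^Δ + ε`.

A predictor that outputs `x` with probability proportional to the excess, hence about `2^(-n)` times
the excess over `M`, would then hit `Y` with probability above `2^(-n) 2^Δ = 2^(-k)`, a
contradiction. Rejection sampling produces such an `x`: accept a uniform `x` if a random level `t`
satisfies `τ z ≤ t < D(x,z)`. The value `τ z` is unknown to the circuit, but `τ z ≤ t` can be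
replaced by the condition that the mean excess over `t` is at most `M`, which sampling can test
(`exists_excess_sampler`, `exists_highEntropy_of_unpredictable`). Treating `D` and its reflection,
and mixing the two laws obtained, gives the two-sided bound.

HILL entropy. If every law of high entropy were distinguished by some small Boolean circuit, a
minimax principle would give one distribution on circuits that distinguishes them all. By a Chernoff
and a union bound over the `2^(n+m)` inputs, the average of `O((n+m)/δ²)` of these circuits
approximates that mixture everywhere, and this average is a deterministic circuit with real-valued
output that contradicts metric entropy.

Size bounds below one gate are treated separately, since `s` may then be too small for any predictor
with gates. -/

namespace CompEntropy

open scoped BigOperators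

/-! ### Composition of circuits -/

section Composition

variable {ι κ α β : Type} {g h : ℕ}

/-- A wire of a netlist, seen as a wire of a longer netlist. -/
def Wire.extend (h : ℕ) : Wire ι g → Wire ι (g + h)
  | .const b => .const b
  | .input i => .input i
  | .gate j => .gate (j.castAdd h)

/-- A wire of a netlist whose inputs are the wires `w` of another netlist. -/
def Wire.subst (w : κ → Wire ι g) : Wire κ h → Wire ι (g + h)
  | .const b => .const b
  | .input i => (w i).extend h
  | .gate j => .gate (j.natAdd g)

/-- The netlist `N` followed by a netlist whose inputs are the wires `w` of `N`. -/
def Netlist.append (N : Netlist ι g) (w : κ → Wire ι g) : {h : ℕ} → Netlist κ h → Netlist ι (g + h)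
  | _, .nil => N
  | _, .snoc M op a b => .snoc (N.append w M) op (a.subst w) (b.subst w)

theorem Wire.val_extend (W : Wire ι g) (x : ι → Bool) (v : Fin g → Bool) (v' : Fin (g + h) → Bool)
    (hv : ∀ j, v' (j.castAdd h) = v j) : (W.extend h).val x v' = W.val x v := by
  cases W <;> simp [Wire.extend, Wire.val, hv]

theorem Wire.val_subst (w : κ → Wire ι g) (W : Wire κ h) (x : ι → Bool) (v : Fin g → Bool)
    (u : Fin h → Bool) (v' : Fin (g + h) → Bool) (hv : ∀ j, v' (j.castAdd h) = v j)
    (hu : ∀ j, v' (j.natAdd g) = u j) :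
    (W.subst w).val x v' = W.val (fun i => (w i).val x v) u := by
  cases W with
  | const b => rfl
  | input i => exact Wire.val_extend _ _ _ _ hv
  | gate j => exact hu j

theorem Netlist.vals_append (N : Netlist ι g) (w : κ → Wire ι g) (x : ι → Bool) (M : Netlist κ h) :
    (∀ j, (N.append w M).vals x (j.castAdd h) = N.vals x j) ∧
      ∀ j, (N.append w M).vals x (j.natAdd g) = M.vals (fun i => (w i).val x (N.vals x)) j := by
  induction M with
  | nil => exact ⟨fun j => rfl, fun j => j.elim0⟩
  | @snoc h M op a b ih =>
    obtain ⟨h1, h2⟩ := ih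
    refine ⟨fun j => ?_, fun j => ?_⟩
    · rw [← h1]
      exact Fin.snoc_castSucc (α := fun _ => Bool) _ _ (j.castAdd h)
    · refine Fin.lastCases ?_ (fun j => ?_) j
      · have e : Fin.natAdd g (Fin.last h) = Fin.last (g + h) := rfl
        rw [e]
        simp only [Netlist.append, Netlist.vals, Fin.snoc_last]
        rw [Wire.val_subst w a x _ _ _ h1 h2, Wire.val_subst w b x _ _ _ h1 h2]
        exact Fin.snoc_last (α := fun _ => Bool) _ _
      · have e : Fin.natAdd g j.castSucc = (Fin.natAdd g j).castSucc := rfl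
        rw [e]
        simp only [Netlist.append, Netlist.vals, Fin.snoc_castSucc]
        exact h2 j

/-- `f` is computed by a netlist of at most `g` gates. -/
def Computes (g : ℕ) (f : (ι → Bool) → κ → Bool) : Prop :=
  ∃ (s : ℕ) (N : Netlist ι s) (o : κ → Wire ι s), s ≤ g ∧ ∀ x i, (o i).val x (N.vals x) = f x i

/-- The Boolean function `f` is computed by a netlist of at most `g` gates. -/
def Decides (g : ℕ) (f : (ι → Bool) → Bool) : Prop :=
  Computes g fun x (_ : Unit) => f x

theorem Computes.mono {f : (ι → Bool) → κ → Bool} (hf : Computes g f) (hgh : g ≤ h) :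
    Computes h f := by
  obtain ⟨s, N, o, hs, H⟩ := hf
  exact ⟨s, N, o, hs.trans hgh, H⟩

theorem Decides.mono {f : (ι → Bool) → Bool} (hf : Decides g f) (hgh : g ≤ h) : Decides h f :=
  Computes.mono hf hgh

theorem Computes.congr {f f' : (ι → Bool) → κ → Bool} (hf : Computes g f)
    (hff : ∀ x i, f x i = f' x i) : Computes g f' := by
  obtain ⟨s, N, o, hs, H⟩ := hf
  exact ⟨s, N, o, hs, fun x i => (H x i).trans (hff x i)⟩

theorem Decides.congr {f f' : (ι → Bool) → Bool} (hf : Decides g f) (hff : ∀ x, f x = f' x) :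
    Decides g f' :=
  Computes.congr hf fun x _ => hff x

theorem Computes.reindex {f : (ι → Bool) → κ → Bool} (hf : Computes g f) (e : α → κ) :
    Computes g fun x a => f x (e a) := by
  obtain ⟨s, N, o, hs, H⟩ := hf
  exact ⟨s, N, fun a => o (e a), hs, fun x i => H x (e i)⟩

theorem Decides.computes {f : (ι → Bool) → Bool} (hf : Decides g f) :
    Computes g fun x (_ : κ) => f x :=
  Computes.reindex hf fun _ => ()

theorem computes_wires (e : κ → ι) : Computes 0 fun (x : ι → Bool) i => x (e i) :=
  ⟨0, .nil, fun i => .input (e i), le_rfl, fun _ _ => rfl⟩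

theorem decides_wire (i : ι) : Decides 0 fun (x : ι → Bool) => x i :=
  computes_wires fun _ => i

theorem decides_const (b : Bool) : Decides 0 fun (_ : ι → Bool) => b :=
  ⟨0, .nil, fun _ => .const b, le_rfl, fun _ _ => rfl⟩

theorem Computes.comp {f : (ι → Bool) → κ → Bool} {f' : (κ → Bool) → α → Bool}
    (hf' : Computes h f') (hf : Computes g f) : Computes (g + h) fun x => f' (f x) := by
  obtain ⟨s, N, o, hs, H⟩ := hf
  obtain ⟨s', N', o', hs', H'⟩ := hf'
  refine ⟨s + s', N.append o N', fun i => (o' i).subst o, by omega, fun x i => ?_⟩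
  obtain ⟨h1, h2⟩ := N.vals_append o x N'
  rw [Wire.val_subst o (o' i) x _ _ _ h1 h2, H']
  congr
  funext i
  exact H x i

theorem Decides.comp {f : (ι → Bool) → κ → Bool} {f' : (κ → Bool) → Bool}
    (hf' : Decides h f') (hf : Computes g f) : Decides (g + h) fun x => f' (f x) :=
  Computes.comp hf' hf

/-- Feeding inputs to a circuit costs nothing. -/
theorem Computes.input {f' : (κ → Bool) → α → Bool} (hf' : Computes h f') (e : κ → ι) :
    Computes h fun (x : ι → Bool) => f' fun i => x (e i) :=
  (hf'.comp (computes_wires e)).mono (by omega)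

theorem Decides.input {f' : (κ → Bool) → Bool} (hf' : Decides h f') (e : κ → ι) :
    Decides h fun (x : ι → Bool) => f' fun i => x (e i) :=
  Computes.input hf' e

theorem Computes.sumElim {f : (ι → Bool) → α → Bool} {f' : (ι → Bool) → β → Bool}
    (hf : Computes g f) (hf' : Computes h f') :
    Computes (g + h) fun x => Sum.elim (f x) (f' x) := by
  obtain ⟨s, N, o, hs, H⟩ := hf
  obtain ⟨s', N', o', hs', H'⟩ := hf'
  refine ⟨s + s', N.append Wire.input N',
    Sum.elim (fun i => (o i).extend s') (fun i => (o' i).subst Wire.input), by omega, fun x i => ?_⟩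
  obtain ⟨h1, h2⟩ := N.vals_append Wire.input x N'
  cases i with
  | inl i => exact (Wire.val_extend _ x _ _ h1).trans (H x i)
  | inr i => exact (Wire.val_subst _ _ x _ _ _ h1 h2).trans (H' x i)

theorem Decides.gate {f f' : (ι → Bool) → Bool} (hf : Decides g f) (hf' : Decides h f')
    (op : Bool → Bool → Bool) : Decides (g + h + 1) fun x => op (f x) (f' x) := by
  have hop : Decides 1 fun v : Unit ⊕ Unit → Bool => op (v (.inl ())) (v (.inr ())) :=
    ⟨1, .snoc .nil op (.input (.inl ())) (.input (.inr ())), fun _ => .gate 0, le_rfl,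
      fun _ _ => rfl⟩
  exact hop.comp (hf.sumElim hf')

theorem Decides.not {f : (ι → Bool) → Bool} (hf : Decides g f) :
    Decides (g + 1) fun x => !f x :=
  hf.gate (decides_const false) fun a _ => !a

/-- Running `q` circuits side by side. -/
theorem computes_family (q : ℕ) {f : Fin q → (ι → Bool) → Bool} (hf : ∀ i, Decides g (f i)) :
    Computes (q * g) fun x i => f i x := by
  induction q with
  | zero => exact ⟨0, .nil, fun i => i.elim0, by omega, fun _ i => i.elim0⟩
  | succ q ih =>
    have h1 := (ih fun i => hf i.castSucc).sumElim (hf (Fin.last q))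
    refine ((h1.reindex (Fin.lastCases (motive := fun _ => Fin q ⊕ Unit) (.inr ()) .inl)).congr
      fun x i => ?_).mono (by rw [Nat.succ_mul])
    refine Fin.lastCases ?_ (fun i => ?_) i <;> simp

theorem computes_fintype [Fintype κ] {f : κ → (ι → Bool) → Bool} (hf : ∀ i, Decides g (f i)) :
    Computes (Fintype.card κ * g) fun x i => f i x :=
  ((computes_family _ fun i => hf ((Fintype.equivFin κ).symm i)).reindex
    (Fintype.equivFin κ)).congr fun x i => by simp

end Composition

/-! ### Arithmetic circuits -/

section Arithmetic

variable {ι κ α : Type} {ℓ g h : ℕ}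

/-- The number with binary digits `a`, the least significant digit first. -/
def num (a : Fin ℓ → Bool) : ℕ := ∑ i, if a i then 2 ^ (i : ℕ) else 0

theorem num_succ (a : Fin (ℓ + 1) → Bool) :
    num a = num (fun i => a i.castSucc) + if a (Fin.last ℓ) then 2 ^ ℓ else 0 := by
  simp [num, Fin.sum_univ_castSucc]

theorem num_lt (a : Fin ℓ → Bool) : num a < 2 ^ ℓ := by
  induction ℓ with
  | zero => simp [num]
  | succ ℓ ih =>
    have := ih fun i => a i.castSucc
    rw [num_succ, pow_succ]
    split <;> omega

theorem num_injective : Function.Injective (num : (Fin ℓ → Bool) → ℕ) := by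
  induction ℓ with
  | zero => exact fun a b _ => funext fun i => i.elim0
  | succ ℓ ih =>
    intro a b hab
    rw [num_succ, num_succ] at hab
    have ha := num_lt fun i => a i.castSucc
    have hb := num_lt fun i => b i.castSucc
    have hl : a (Fin.last ℓ) = b (Fin.last ℓ) := by
      cases h1 : a (Fin.last ℓ) <;> cases h2 : b (Fin.last ℓ) <;> simp [h1, h2] at hab ⊢ <;> omega
    rw [hl, add_left_inj] at hab
    have := ih hab
    funext i
    refine Fin.lastCases hl (fun i => congrFun this i) i

/-- Bit strings of length `ℓ` are the numbers below `2 ^ ℓ`. -/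
noncomputable def numEquiv (ℓ : ℕ) : (Fin ℓ → Bool) ≃ Fin (2 ^ ℓ) :=
  Equiv.ofBijective (fun a => ⟨num a, num_lt a⟩)
    ((Fintype.bijective_iff_injective_and_card _).2
      ⟨fun a b hab => num_injective (by simpa using hab), by simp⟩)

theorem sum_num {M : Type*} [AddCommMonoid M] (f : ℕ → M) :
    ∑ a : Fin ℓ → Bool, f (num a) = ∑ j ∈ Finset.range (2 ^ ℓ), f j := by
  rw [Finset.sum_range, ← (numEquiv ℓ).sum_comp]
  rfl

theorem exists_num_eq {j : ℕ} (hj : j < 2 ^ ℓ) : ∃ a : Fin ℓ → Bool, num a = j :=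
  ⟨(numEquiv ℓ).symm ⟨j, hj⟩, congrArg Fin.val ((numEquiv ℓ).apply_symm_apply ⟨j, hj⟩)⟩

/-- The top digits decide if they differ; otherwise the comparison of the lower digits does. Each
digit costs four gates. -/
theorem decides_num_lt (ℓ : ℕ) :
    Decides (4 * ℓ) fun x : Fin ℓ ⊕ Fin ℓ → Bool =>
      decide (num (fun i => x (.inl i)) < num fun i => x (.inr i)) := by
  induction ℓ with
  | zero => exact (decides_const false).congr fun x => by simp [num]
  | succ ℓ ih =>
    have h0 := ih.input (Sum.map Fin.castSucc Fin.castSucc)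
    have ha := decides_wire (ι := Fin (ℓ + 1) ⊕ Fin (ℓ + 1)) (.inl (Fin.last ℓ))
    have hb := decides_wire (ι := Fin (ℓ + 1) ⊕ Fin (ℓ + 1)) (.inr (Fin.last ℓ))
    refine (((ha.gate hb fun a b => !a && b).gate ((ha.gate hb fun a b => !a || b).gate h0 and)
      or).congr fun x => ?_).mono (by omega)
    rw [num_succ fun i => x (.inl i), num_succ fun i => x (.inr i)]
    have h1 := num_lt fun i : Fin ℓ => x (.inl i.castSucc)
    have h2 := num_lt fun i : Fin ℓ => x (.inr i.castSucc)
    rw [Bool.eq_iff_iff]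
    cases x (.inl (Fin.last ℓ)) <;> cases x (.inr (Fin.last ℓ)) <;>
      simp <;> first | exact decide_eq_true_iff | omega

theorem Computes.num_lt {a b : (ι → Bool) → Fin ℓ → Bool} (ha : Computes g a) (hb : Computes h b) :
    Decides (g + h + 4 * ℓ) fun x => decide (num (a x) < num (b x)) :=
  (decides_num_lt ℓ).comp (ha.sumElim hb)

/-- A ripple-carry adder: the top digit of the sum of the lower parts is the carry, and each digit
costs one full adder of five gates. -/
theorem computes_add (ℓ : ℕ) :
    ∃ f : (Fin ℓ ⊕ Fin ℓ → Bool) → Fin (ℓ + 1) → Bool, Computes (5 * ℓ) f ∧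
      ∀ x, num (f x) = num (fun i => x (.inl i)) + num fun i => x (.inr i) := by
  induction ℓ with
  | zero => exact ⟨_, (decides_const false).computes, fun x => by simp [num]⟩
  | succ ℓ ih =>
    obtain ⟨f, hf, H⟩ := ih
    have h0 := hf.input (Sum.map Fin.castSucc Fin.castSucc : _ → Fin (ℓ + 1) ⊕ Fin (ℓ + 1))
    have hid : Computes 0 fun x : Fin (ℓ + 1) ⊕ Fin (ℓ + 1) → Bool => x := computes_wires id
    have h1 := hid.sumElim h0
    -- The three bits that enter the last full adder.
    have ha := decides_wire (ι := Unit ⊕ Unit ⊕ Unit) (.inl ())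
    have hb := decides_wire (ι := Unit ⊕ Unit ⊕ Unit) (.inr (.inl ()))
    have hc := decides_wire (ι := Unit ⊕ Unit ⊕ Unit) (.inr (.inr ()))
    have full : Computes 5 fun (x : Unit ⊕ Unit ⊕ Unit → Bool) (i : Unit ⊕ Unit) =>
        Sum.elim (fun _ => xor (xor (x (.inl ())) (x (.inr (.inl ())))) (x (.inr (.inr ()))))
          (fun _ => (x (.inl ()) && x (.inr (.inl ()))) ||
            (xor (x (.inl ())) (x (.inr (.inl ()))) && x (.inr (.inr ())))) i := by
      have p := (computes_wires (id : Unit ⊕ Unit ⊕ Unit → _)).sumElim (ha.gate hb xor)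
      have q : Computes 4 fun (y : (Unit ⊕ Unit ⊕ Unit) ⊕ Unit → Bool) (i : Unit ⊕ Unit) =>
          Sum.elim (fun _ => xor (y (.inr ())) (y (.inl (.inr (.inr ())))))
            (fun _ => (y (.inl (.inl ())) && y (.inl (.inr (.inl ())))) ||
              (y (.inr ()) && y (.inl (.inr (.inr ()))))) i :=
        (((decides_wire _).gate (decides_wire _) xor).sumElim
          (((decides_wire _).gate (decides_wire _) and).gate
            ((decides_wire _).gate (decides_wire _) and) or))
      exact q.comp p
    let e : Unit ⊕ Unit ⊕ Unit → (Fin (ℓ + 1) ⊕ Fin (ℓ + 1)) ⊕ Fin (ℓ + 1) :=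
      Sum.elim (fun _ => .inl (.inl (Fin.last ℓ)))
        (Sum.elim (fun _ => .inl (.inr (Fin.last ℓ))) fun _ => .inr (Fin.last ℓ))
    have h2 := (computes_wires (id : (Fin (ℓ + 1) ⊕ Fin (ℓ + 1)) ⊕ Fin (ℓ + 1) → _)).sumElim
      (full.input e)
    have h3 := h2.comp h1
    let o : Fin (ℓ + 2) → ((Fin (ℓ + 1) ⊕ Fin (ℓ + 1)) ⊕ Fin (ℓ + 1)) ⊕ (Unit ⊕ Unit) :=
      Fin.lastCases (motive := fun _ => _) (.inr (.inr ()))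
        (Fin.lastCases (motive := fun _ => _) (.inr (.inl ())) fun i => .inl (.inr i.castSucc))
    refine ⟨_, (h3.reindex o).mono (by omega), fun x => ?_⟩
    rw [num_succ, num_succ, num_succ fun i => x (.inl i), num_succ fun i => x (.inr i)]
    have h4 := H fun i => x (Sum.map Fin.castSucc Fin.castSucc i)
    rw [num_succ] at h4
    simp only [Sum.map_inl, Sum.map_inr] at h4
    simp only [o, e, Fin.lastCases_last, Fin.lastCases_castSucc, Sum.elim_inl, Sum.elim_inr]
    generalize (f fun i => x (Sum.map Fin.castSucc Fin.castSucc i)) = y at h4 ⊢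
    simp only [id]
    rw [pow_succ]
    cases x (.inl (Fin.last ℓ)) <;> cases x (.inr (Fin.last ℓ)) <;>
      cases h7 : y (Fin.last ℓ) <;> simp [h7] at h4 ⊢ <;> omega

/-- Counting the ones among `2 ^ h` bits. -/
theorem computes_count_aux (h : ℕ) :
    ∃ (κ : Type) (_ : Fintype κ) (f : (κ → Bool) → Fin (h + 1) → Bool), Fintype.card κ = 2 ^ h ∧
      (∃ g, g + 5 * h + 10 = 10 * 2 ^ h ∧ Computes g f) ∧
      ∀ x, num (f x) = ∑ i, (x i).toNat := by
  induction h with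
  | zero =>
    exact ⟨Unit, inferInstance, fun x _ => x (), rfl, ⟨0, by norm_num, computes_wires _⟩,
      fun x => by cases h : x () <;> simp [num, h]⟩
  | succ h ih =>
    obtain ⟨κ, _, f, hκ, ⟨g, hg, hf⟩, H⟩ := ih
    obtain ⟨f', hf', H'⟩ := computes_add (h + 1)
    refine ⟨κ ⊕ κ, inferInstance, fun x => f' (Sum.elim (f fun i => x (.inl i))
      (f fun i => x (.inr i))), by simp [hκ, pow_succ, mul_two], ⟨g + g + 5 * (h + 1), ?_,
      hf'.comp ((hf.input Sum.inl).sumElim (hf.input Sum.inr))⟩, fun x => ?_⟩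
    -- The number of gates obeys `g ↦ 2 g + 5 (h + 1)`, with the exact solution `10 * 2 ^ h - 5 * h
    -- - 10`.
    · rw [pow_succ]; omega
    · simp [H', H]

theorem computes_count [Fintype κ] (hκ : Fintype.card κ = 2 ^ h) :
    ∃ f : (κ → Bool) → Fin (h + 1) → Bool, Computes (10 * 2 ^ h) f ∧
      ∀ x, num (f x) = ∑ i, (x i).toNat := by
  obtain ⟨κ', _, f, hκ', ⟨g, hg, hf⟩, H⟩ := computes_count_aux h
  let e : κ' ≃ κ := Fintype.equivOfCardEq (hκ'.trans hκ.symm)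
  refine ⟨_, (hf.input e).mono (by omega), fun x => ?_⟩
  rw [H]
  exact e.sum_comp fun i => (x i).toNat

/-- Testing whether at most `M` of `2 ^ h` bits are ones. -/
theorem decides_count_le [Fintype κ] (hκ : Fintype.card κ = 2 ^ h) (M : ℕ) :
    Decides (18 * 2 ^ h) fun x : κ → Bool => decide ((∑ i, (x i).toNat) ≤ M) := by
  obtain ⟨f, hf, H⟩ := computes_count hκ
  have hh : h + 1 ≤ 2 ^ h := Nat.lt_two_pow_self
  have hle : ∀ x : κ → Bool, (∑ i, (x i).toNat) ≤ 2 ^ h := fun x => by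
    rw [← hκ, ← Finset.card_univ, Finset.card_eq_sum_ones]
    exact Finset.sum_le_sum fun i _ => Bool.toNat_le _
  by_cases hM : M < 2 ^ (h + 1)
  · obtain ⟨a, ha⟩ := exists_num_eq hM
    have hc : Computes 0 fun (_ : κ → Bool) => a :=
      ⟨0, .nil, fun i => .const (a i), le_rfl, fun _ _ => rfl⟩
    refine ((((hc.num_lt hf).gate (decides_const false) fun b _ => !b)).congr fun x => ?_).mono
      (g := 0 + 10 * 2 ^ h + 4 * (h + 1) + 0 + 1) ?_
    · simp only [ha, H, ← not_lt, decide_not]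
    · omega
  -- A bound that does not fit into `h + 1` digits exceeds the number of bits, so the test is
  -- constant.
  · refine ((decides_const true).congr fun x => ?_).mono (Nat.zero_le _)
    have := hle x
    rw [pow_succ] at hM
    simp only [true_eq_decide_iff]
    omega

end Arithmetic

/-! ### A Chernoff bound for finite product distributions -/

section Chernoff

variable {Ω K : Type*} [Fintype Ω] [Fintype K] [DecidableEq K] {w f : Ω → ℝ} {κ : ℝ}

/-- From `exp u ≤ 1 + u + u ^ 2` for `|u| ≤ 1`: the linear term averages to zero. -/
theorem sum_mul_exp_le (hw : w ∈ stdSimplex ℝ Ω) (hf0 : ∀ a, 0 ≤ f a) (hf1 : ∀ a, f a ≤ 1)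
    {l : ℝ} (hl0 : 0 ≤ l) (hl1 : l ≤ 1) :
    ∑ a, w a * Real.exp (l * (f a - ∑ b, w b * f b)) ≤ Real.exp (l ^ 2) := by
  set M := ∑ b, w b * f b with hM
  have hM0 : 0 ≤ M := Finset.sum_nonneg fun a _ => mul_nonneg (hw.1 a) (hf0 a)
  have hM1 : M ≤ 1 := by
    rw [← hw.2]
    exact Finset.sum_le_sum fun a _ => mul_le_of_le_one_right (hw.1 a) (hf1 a)
  have key : ∀ a, w a * Real.exp (l * (f a - M)) ≤ w a * (1 + l ^ 2) + l * (w a * f a - w a * M) := by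
    intro a
    have h1 : |f a - M| ≤ 1 := abs_le.2 ⟨by linarith [hf0 a], by linarith [hf1 a]⟩
    have h2 : |l * (f a - M)| ≤ 1 := by
      rw [abs_mul, abs_of_nonneg hl0]
      exact mul_le_one₀ hl1 (abs_nonneg _) h1
    have h3 := (abs_le.1 (Real.abs_exp_sub_one_sub_id_le h2)).2
    have h4 : (l * (f a - M)) ^ 2 ≤ l ^ 2 := by
      rw [mul_pow]
      exact mul_le_of_le_one_right (sq_nonneg _) ((sq_le_one_iff_abs_le_one _).2 h1)
    have := mul_le_mul_of_nonneg_left (show Real.exp (l * (f a - M)) ≤ 1 + l ^ 2 + l * (f a - M) by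
      linarith) (hw.1 a)
    linarith
  refine (Finset.sum_le_sum fun a _ => key a).trans ?_
  rw [Finset.sum_add_distrib, ← Finset.sum_mul, ← Finset.mul_sum, Finset.sum_sub_distrib,
    ← Finset.sum_mul, hw.2, ← hM]
  linarith [Real.add_one_le_exp (l ^ 2)]

/-- The indicator is dominated by an exponential with parameter `l = κ / 2`, which factorizes; each
factor is at most `exp (κ ^ 2 / 4) * exp (-(κ ^ 2 / 2))`. -/
theorem chernoff_upper (hw : w ∈ stdSimplex ℝ Ω) (hf0 : ∀ a, 0 ≤ f a) (hf1 : ∀ a, f a ≤ 1)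
    (hκ0 : 0 ≤ κ) (hκ1 : κ ≤ 1) :
    (∑ ω : K → Ω, (∏ i, w (ω i)) *
      if Fintype.card K * (∑ a, w a * f a + κ) ≤ ∑ i, f (ω i) then 1 else 0) ≤
      Real.exp (-(Fintype.card K * κ ^ 2 / 4)) := by
  set M := ∑ b, w b * f b
  have h1 : ∀ ω : K → Ω, ((∏ i, w (ω i)) *
      if Fintype.card K * (M + κ) ≤ ∑ i, f (ω i) then (1 : ℝ) else 0) ≤
      ∏ i, w (ω i) * (Real.exp (κ / 2 * (f (ω i) - M)) * Real.exp (-(κ ^ 2 / 2))) := by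
    intro ω
    rw [Finset.prod_mul_distrib]
    refine mul_le_mul_of_nonneg_left ?_ (Finset.prod_nonneg fun i _ => hw.1 _)
    simp_rw [← Real.exp_add]
    rw [← Real.exp_sum]
    split_ifs with h
    · rw [Real.one_le_exp_iff, Finset.sum_add_distrib, ← Finset.mul_sum, Finset.sum_sub_distrib]
      simp only [Finset.sum_const, Finset.card_univ, nsmul_eq_mul]
      nlinarith
    · exact (Real.exp_pos _).le
  refine (Finset.sum_le_sum fun ω _ => h1 ω).trans ?_
  rw [← Fintype.piFinset_univ, ← Finset.prod_univ_sum (fun _ => Finset.univ)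
    fun _ a => w a * (Real.exp (κ / 2 * (f a - M)) * Real.exp (-(κ ^ 2 / 2)))]
  simp_rw [← mul_assoc, ← Finset.sum_mul]
  have h2 := sum_mul_exp_le hw hf0 hf1 (l := κ / 2) (by linarith) (by linarith)
  rw [Finset.prod_const, Finset.card_univ]
  calc _ ≤ (Real.exp ((κ / 2) ^ 2) * Real.exp (-(κ ^ 2 / 2))) ^ Fintype.card K := by
        refine pow_le_pow_left₀ ?_ (mul_le_mul_of_nonneg_right h2 (Real.exp_pos _).le) _
        exact mul_nonneg (Finset.sum_nonneg fun a _ => mul_nonneg (hw.1 a) (Real.exp_pos _).le)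
          (Real.exp_pos _).le
    _ = _ := by
        rw [← Real.exp_add, ← Real.exp_nat_mul]
        congr 1
        ring

theorem chernoff_lower (hw : w ∈ stdSimplex ℝ Ω) (hf0 : ∀ a, 0 ≤ f a) (hf1 : ∀ a, f a ≤ 1)
    (hκ0 : 0 ≤ κ) (hκ1 : κ ≤ 1) :
    (∑ ω : K → Ω, (∏ i, w (ω i)) *
      if ∑ i, f (ω i) ≤ Fintype.card K * (∑ a, w a * f a - κ) then 1 else 0) ≤
      Real.exp (-(Fintype.card K * κ ^ 2 / 4)) := by
  refine le_of_eq_of_le ?_ (chernoff_upper (K := K) (f := fun a => 1 - f a) hw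
    (fun a => by linarith [hf1 a]) (fun a => by linarith [hf0 a]) hκ0 hκ1)
  simp only [mul_sub, mul_one, Finset.sum_sub_distrib, hw.2, Finset.sum_const, Finset.card_univ,
    nsmul_eq_mul]
  refine Finset.sum_congr rfl fun ω _ => ?_
  congr 2
  exact propext ⟨fun h => by linarith, fun h => by linarith⟩

theorem uniform_mem_stdSimplex [Nonempty Ω] :
    (fun _ => (Fintype.card Ω : ℝ)⁻¹) ∈ stdSimplex ℝ Ω :=
  ⟨fun _ => by positivity, by simp⟩

theorem sum_uniform_mul [Nonempty Ω] (f : Ω → ℝ) :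
    ∑ a, (Fintype.card Ω : ℝ)⁻¹ * f a = 𝔼 a, f a := by
  rw [← Finset.mul_sum, Fintype.expect_eq_sum_div_card, div_eq_inv_mul]

theorem sum_uniform_prod_mul (F : (K → Ω) → ℝ) :
    ∑ ω : K → Ω, (∏ _i : K, (Fintype.card Ω : ℝ)⁻¹) * F ω = 𝔼 ω, F ω := by
  rw [← Finset.mul_sum, Fintype.expect_eq_sum_div_card, div_eq_inv_mul]
  simp

end Chernoff

/-! ### Randomized circuits with a prescribed output distribution -/

section Randomized

variable {ι κ α β : Type} {g h : ℕ}

theorem expect_sumArrow [Fintype α] [Fintype β] [DecidableEq α] [DecidableEq β]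
    (F : (α ⊕ β → Bool) → ℝ) : 𝔼 ω, F ω = 𝔼 a : α → Bool, 𝔼 b : β → Bool, F (Sum.elim a b) := by
  rw [← Finset.expect_product', Finset.univ_product_univ]
  refine Fintype.expect_equiv (Equiv.sumArrowEquivProdArrow α β Bool) _ _ fun ω => ?_
  congr
  funext i
  cases i <;> rfl

theorem expect_curry [Fintype α] [Fintype β] [DecidableEq α] [DecidableEq β]
    (F : (α → β → Bool) → ℝ) : 𝔼 ω : α × β → Bool, F (fun a b => ω (a, b)) = 𝔼 ω, F ω :=
  Fintype.expect_equiv (Equiv.curry α β Bool) _ _ fun _ => rfl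

/-- The indicator of equality of two bit strings. -/
def same [Fintype κ] (a b : κ → Bool) : ℝ := if a = b then 1 else 0

theorem same_nonneg [Fintype κ] (a b : κ → Bool) : 0 ≤ same a b := by
  unfold same; split <;> norm_num

theorem toNat_le_one (b : Bool) : (b.toNat : ℝ) ≤ 1 := by exact_mod_cast Bool.toNat_le b

/-- There is a randomized circuit of at most `g` gates that accepts input `x` with probability
`p x`. -/
def Flips (g : ℕ) (p : (ι → Bool) → ℝ) : Prop :=
  ∃ (c : Type) (_ : Fintype c) (_ : DecidableEq c) (f : (ι ⊕ c → Bool) → Bool), Decides g f ∧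
    ∀ x, p x = 𝔼 ω : c → Bool, ((f (Sum.elim x ω)).toNat : ℝ)

/-- There is a randomized circuit of at most `g` gates that outputs `y` on input `x` with
probability `p x y`. -/
def Samples [Fintype κ] (g : ℕ) (p : (ι → Bool) → (κ → Bool) → ℝ) : Prop :=
  ∃ (c : Type) (_ : Fintype c) (_ : DecidableEq c) (f : (ι ⊕ c → Bool) → κ → Bool), Computes g f ∧
    ∀ x y, p x y = 𝔼 ω : c → Bool, same (f (Sum.elim x ω)) y

theorem Flips.mono {p : (ι → Bool) → ℝ} (hp : Flips g p) (hgh : g ≤ h) : Flips h p := by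
  obtain ⟨c, i1, i2, f, hf, H⟩ := hp
  exact ⟨c, i1, i2, f, hf.mono hgh, H⟩

theorem Flips.nonneg {p : (ι → Bool) → ℝ} (hp : Flips g p) (x : ι → Bool) : 0 ≤ p x := by
  obtain ⟨c, _, _, f, hf, H⟩ := hp
  rw [H]
  exact Finset.expect_nonneg fun ω _ => Nat.cast_nonneg _

theorem Flips.le_one {p : (ι → Bool) → ℝ} (hp : Flips g p) (x : ι → Bool) : p x ≤ 1 := by
  obtain ⟨c, _, _, f, hf, H⟩ := hp
  rw [H]
  exact Finset.expect_le Finset.univ_nonempty fun ω _ => toNat_le_one _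

theorem Samples.nonneg [Fintype κ] {p : (ι → Bool) → (κ → Bool) → ℝ} (hp : Samples g p)
    (x : ι → Bool) (y : κ → Bool) : 0 ≤ p x y := by
  obtain ⟨c, _, _, f, hf, H⟩ := hp
  rw [H]
  exact Finset.expect_nonneg fun ω _ => same_nonneg _ _

/-- Some of the inputs of a randomized circuit are replaced by coins. -/
theorem Flips.randomize [Fintype κ] [DecidableEq κ] {p : (ι ⊕ κ → Bool) → ℝ} (hp : Flips g p) :
    Flips g fun x => 𝔼 y : κ → Bool, p (Sum.elim x y) := by
  obtain ⟨c, _, _, f, hf, H⟩ := hp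
  refine ⟨κ ⊕ c, inferInstance, inferInstance, _, hf.input (ι := ι ⊕ (κ ⊕ c))
    (Sum.elim (Sum.elim .inl fun i => .inr (.inl i)) fun i => .inr (.inr i)), fun x => ?_⟩
  rw [expect_sumArrow]
  refine Finset.expect_congr rfl fun y _ => ?_
  rw [H]
  refine Finset.expect_congr rfl fun ω _ => ?_
  congr 3
  funext i
  rcases i with (i | i) | i <;> rfl

theorem Decides.and_flips {f : (ι → Bool) → Bool} {p : (ι → Bool) → ℝ} (hf : Decides h f)
    (hp : Flips g p) : Flips (h + g + 1) fun x => ((f x).toNat : ℝ) * p x := by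
  obtain ⟨c, _, _, f', hf', H⟩ := hp
  refine ⟨c, inferInstance, inferInstance, _, (hf.input Sum.inl).gate hf' and, fun x => ?_⟩
  simp only [Sum.elim_inl, H]
  rw [show (fun i => x i) = x from rfl]
  cases f x <;> simp

theorem Decides.flips {f : (ι → Bool) → Bool} (hf : Decides g f) :
    Flips g fun x => ((f x).toNat : ℝ) :=
  ⟨Empty, inferInstance, inferInstance, _, hf.input Sum.inl, fun x => by
    simp only [Sum.elim_inl, Fintype.expect_const]⟩

theorem Flips.input {p : (κ → Bool) → ℝ} (hp : Flips g p) (e : κ → ι) :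
    Flips g fun x => p fun i => x (e i) := by
  obtain ⟨c, _, _, f, hf, H⟩ := hp
  refine ⟨c, inferInstance, inferInstance, _, hf.input (Sum.map e id), fun x => ?_⟩
  simp only [H]
  refine Finset.expect_congr rfl fun ω _ => ?_
  congr 3
  funext i
  cases i <;> rfl

/-- By repeated sampling, a randomized circuit can tell whether the acceptance probability of
another one is at most `M` or at least `M + η`. -/
theorem Flips.threshold {p : (ι → Bool) → ℝ} (hp : Flips g p) {M η ρ : ℝ} (hM : 0 ≤ M)
    (hη0 : 0 ≤ η) (hη1 : η ≤ 1) (hh : Real.exp (-((2 : ℝ) ^ h * (η / 2) ^ 2 / 4)) ≤ ρ) :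
    ∃ r : (ι → Bool) → ℝ, Flips (2 ^ h * (g + 18)) r ∧ (∀ x, p x ≤ M → 1 - ρ ≤ r x) ∧
      ∀ x, M + η ≤ p x → r x ≤ ρ := by
  classical
  obtain ⟨c, _, _, f, hf, H⟩ := hp
  let K := Fin (2 ^ h)
  have hK : Fintype.card K = 2 ^ h := Fintype.card_fin _
  -- The test is run `2 ^ h` times with fresh coins. The count of acceptances is compared with the
  -- midpoint between the two cases, rounded down because the count is an integer.
  set B := ⌊2 ^ h * (M + η / 2)⌋₊
  have h1 : Computes (Fintype.card K * g) fun (x : ι ⊕ (K × c) → Bool) (k : K) =>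
      f (Sum.elim (fun i => x (.inl i)) fun i => x (.inr (k, i))) := by
    refine computes_fintype fun k => (hf.input (Sum.map id fun i => (k, i))).congr fun x => ?_
    congr
    funext i
    cases i <;> rfl
  have h2 := (decides_count_le hK B).comp h1
  refine ⟨_, ⟨K × c, inferInstance, inferInstance, _, h2.mono (by rw [hK, mul_add, mul_comm 18]),
    fun x => rfl⟩, fun x hx => ?_, fun x hx => ?_⟩
  all_goals
    let u : (c → Bool) → ℝ := fun ω => (f (Sum.elim x ω)).toNat
    have hB : ∀ ω : K → c → Bool, ((decide ((∑ k, (f (Sum.elim x (ω k))).toNat) ≤ B)).toNat : ℝ) =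
        if ∑ k, u (ω k) ≤ 2 ^ h * (M + η / 2) then 1 else 0 := fun ω => by
      have : (∑ k, (f (Sum.elim x (ω k))).toNat) ≤ B ↔ ∑ k, u (ω k) ≤ 2 ^ h * (M + η / 2) := by
        rw [Nat.le_floor_iff (by positivity)]
        push_cast
        rfl
      by_cases hω : (∑ k, (f (Sum.elim x (ω k))).toNat) ≤ B
      · rw [if_pos (this.1 hω), decide_eq_true hω]; simp
      · rw [if_neg (mt this.2 hω), decide_eq_false hω]; simp
    have hE := (expect_curry fun ω : K → c → Bool =>
      ((decide ((∑ k, (f (Sum.elim x (ω k))).toNat) ≤ B)).toNat : ℝ)).trans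
        (Finset.expect_congr rfl fun ω _ => hB ω)
    have hu0 : ∀ ω, 0 ≤ u ω := fun ω => Nat.cast_nonneg _
    have hu1 : ∀ ω, u ω ≤ 1 := fun ω => toNat_le_one _
    rw [H] at hx
  · have := chernoff_upper (K := K) uniform_mem_stdSimplex hu0 hu1 (show 0 ≤ η / 2 by linarith)
      (by linarith)
    rw [sum_uniform_mul, sum_uniform_prod_mul, hK] at this
    push_cast at this
    have h3 : ∀ ω : K → c → Bool, 1 - (if 2 ^ h * ((𝔼 a, u a) + η / 2) ≤ ∑ k, u (ω k) then (1 : ℝ) else 0) ≤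
        if ∑ k, u (ω k) ≤ 2 ^ h * (M + η / 2) then (1 : ℝ) else 0 := by
      intro ω
      have : (2 : ℝ) ^ h * ((𝔼 a, u a) + η / 2) ≤ 2 ^ h * (M + η / 2) := by gcongr
      split_ifs <;> linarith
    have h4 := Finset.expect_le_expect fun ω (_ : ω ∈ Finset.univ) => h3 ω
    rw [Finset.expect_sub_distrib, Fintype.expect_const] at h4
    refine le_of_le_of_eq ?_ hE.symm
    linarith
  · have := chernoff_lower (K := K) uniform_mem_stdSimplex hu0 hu1 (show 0 ≤ η / 2 by linarith)
      (by linarith)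
    rw [sum_uniform_mul, sum_uniform_prod_mul, hK] at this
    push_cast at this
    refine hE.trans_le ((Finset.expect_le_expect fun ω _ => ?_).trans (this.trans hh))
    have : (2 : ℝ) ^ h * (M + η / 2) ≤ 2 ^ h * ((𝔼 a, u a) - η / 2) := by gcongr; linarith
    split_ifs <;> linarith

/-- Rejection sampling: at most `T` candidates `y` are drawn uniformly, each of which is accepted
with probability `W (x, y)`, and an accepted one is returned. -/
theorem Flips.rejection [Fintype κ] [DecidableEq κ] {W : (ι ⊕ κ → Bool) → ℝ} (hW : Flips g W)
    (T : ℕ) : ∃ p : (ι → Bool) → (κ → Bool) → ℝ, Samples (T * (g + 3 * Fintype.card κ)) p ∧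
      ∀ x y, W (Sum.elim x y) / 2 ^ Fintype.card κ *
        ∑ i ∈ Finset.range T, (1 - 𝔼 y', W (Sum.elim x y')) ^ i ≤ p x y := by
  have hW0 := hW.nonneg
  have hW1 := hW.le_one
  obtain ⟨c, _, _, f, hf, H⟩ := hW
  induction T with
  | zero =>
    have : Computes 0 fun (_ : ι ⊕ Empty → Bool) (_ : κ) => false := (decides_const false).computes
    exact ⟨_, ⟨Empty, inferInstance, inferInstance, _, this.mono (by omega), fun x y => rfl⟩,
      fun x y => by
        rw [Finset.sum_range_zero, mul_zero]
        exact Finset.expect_nonneg fun ω _ => same_nonneg _ _⟩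
  | succ T ih =>
    obtain ⟨p, ⟨c', _, _, S, hS, HS⟩, ih⟩ := ih
    let I := ι ⊕ (c' ⊕ (κ ⊕ c))
    have h1 := hS.input (Sum.map id .inl : ι ⊕ c' → I)
    have h2 := hf.input (Sum.elim (Sum.map id fun i => .inr (.inl i)) fun i => .inr (.inr (.inr i)) :
      (ι ⊕ κ) ⊕ c → I)
    have h3 : Computes (Fintype.card κ * 3) fun (x : I ⊕ (κ ⊕ Unit) → Bool) k =>
        (x (.inr (.inr ())) && x (.inl (.inr (.inr (.inl k))))) ||
          (!x (.inr (.inr ())) && x (.inr (.inl k))) :=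
      computes_fintype fun k => ((decides_wire _).gate (decides_wire _) and).gate
        ((decides_wire _).gate (decides_wire _) fun a b => !a && b) or
    have h4 := h3.comp ((computes_wires (id : I → I)).sumElim (h1.sumElim h2))
    refine ⟨_, ⟨c' ⊕ (κ ⊕ c), inferInstance, inferInstance, _, h4.mono ?_, fun x y => rfl⟩,
      fun x y => ?_⟩
    · rw [Nat.succ_mul]; ring_nf; exact le_rfl
    set A := 𝔼 y', W (Sum.elim x y') with hA
    set q := W (Sum.elim x y) / 2 ^ Fintype.card κ with hq
    have hA1 : A ≤ 1 := Finset.expect_le Finset.univ_nonempty fun y' _ => hW1 _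
    -- The new candidate is tried first, and if it is rejected the sampler with `T` candidates
    -- supplies the output. This gives the recursion `p ↦ q + (1 - A) p` behind the geometric sum.
    have key : q + (1 - A) * p x y = 𝔼 ω : c' ⊕ (κ ⊕ c) → Bool, same (fun k =>
        (f (fun i => Sum.elim x ω (Sum.elim (Sum.map id fun i => .inr (.inl i))
          (fun i => .inr (.inr (.inr i))) i : I)) && ω (.inr (.inl k))) ||
        (!f (fun i => Sum.elim x ω (Sum.elim (Sum.map id fun i => .inr (.inl i))
          (fun i => .inr (.inr (.inr i))) i : I)) &&
          S (fun i => Sum.elim x ω (Sum.map id .inl i : I)) k)) y := by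
      rw [expect_sumArrow]
      simp_rw [expect_sumArrow]
      have e1 : ∀ (a : c' → Bool) (b : κ → Bool) (b' : c → Bool),
          (fun i => Sum.elim x (Sum.elim a (Sum.elim b b'))
            (Sum.elim (Sum.map id fun i => .inr (.inl i))
              (fun i => .inr (.inr (.inr i))) i : I)) = Sum.elim (Sum.elim x b) b' := by
        intro a b b'
        funext i
        rcases i with (i | i) | i <;> rfl
      have e2 : ∀ (a : c' → Bool) (b : κ → Bool) (b' : c → Bool),
          (fun i => Sum.elim x (Sum.elim a (Sum.elim b b')) (Sum.map id .inl i : I)) =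
            Sum.elim x a := by
        intro a b b'
        funext i
        rcases i with i | i <;> rfl
      simp_rw [e1, e2]
      have e3 : ∀ (a : c' → Bool) (b : κ → Bool) (b' : c → Bool),
          same (fun k => (f (Sum.elim (Sum.elim x b) b') &&
              Sum.elim a (Sum.elim b b') (.inr (.inl k))) ||
              (!f (Sum.elim (Sum.elim x b) b') && S (Sum.elim x a) k)) y =
            ((f (Sum.elim (Sum.elim x b) b')).toNat : ℝ) * same b y +
            (1 - ((f (Sum.elim (Sum.elim x b) b')).toNat : ℝ)) * same (S (Sum.elim x a)) y := by
        intro a b b'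
        cases f (Sum.elim (Sum.elim x b) b') <;> simp
      simp_rw [e3, Finset.expect_add_distrib, ← Finset.expect_mul, Finset.expect_sub_distrib,
        Fintype.expect_const, ← H, ← Finset.mul_expect, ← HS, ← hA]
      simp [hq, same]
      rw [NNRat.smul_def]
      push_cast
      rw [div_eq_inv_mul]
    refine le_of_le_of_eq ?_ key
    rw [geom_sum_succ]
    nlinarith [mul_le_mul_of_nonneg_left (ih x y) (sub_nonneg.2 hA1)]

theorem Samples.exists_probCircuit {o : ℕ} {p : (ι → Bool) → BitStr o → ℝ} (hp : Samples g p) :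
    ∃ C : ProbCircuit ι o, C.size ≤ g ∧ ∀ x y, C.prob x y = p x y := by
  obtain ⟨c, _, _, f, hf, H⟩ := hp
  obtain ⟨s, N, o, hs, H'⟩ := hf.input (Sum.map id (Fintype.equivFin c) :
    ι ⊕ c → ι ⊕ Fin (Fintype.card c))
  refine ⟨⟨_, ⟨s, N, o⟩⟩, hs, fun x y => ?_⟩
  have h1 : ∀ ω : Fin (Fintype.card c) → Bool,
      Circuit.eval ⟨s, N, o⟩ (Sum.elim x ω) = f (Sum.elim x fun i => ω (Fintype.equivFin c i)) := by
    intro ω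
    funext i
    refine (H' _ i).trans ?_
    change f _ i = f _ i
    congr
    funext j
    cases j <;> rfl
  simp only [ProbCircuit.prob, h1]
  rw [H, Fintype.expect_eq_sum_div_card]
  congr 1
  · exact Fintype.sum_equiv (Equiv.arrowCongr (Fintype.equivFin c).symm (Equiv.refl _)) _ _
      fun ω => rfl
  · simp

theorem Flips.exists_probCircuit {p : (ι → Bool) → ℝ} (hp : Flips g p) :
    ∃ C : ProbCircuit ι 1, C.size ≤ g ∧ ∀ x, C.prob x (fun _ => true) = p x := by
  obtain ⟨c, _, _, f, hf, H⟩ := hp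
  obtain ⟨C, hC, hp⟩ := Samples.exists_probCircuit (g := g) (o := 1) (p := fun x y =>
    𝔼 ω : c → Bool, same (fun _ => f (Sum.elim x ω)) y)
    ⟨c, inferInstance, inferInstance, _, Decides.computes hf, fun x y => rfl⟩
  refine ⟨C, hC, fun x => ?_⟩
  rw [hp, H]
  refine Finset.expect_congr rfl fun ω _ => ?_
  cases f (Sum.elim x ω) <;> simp [same, funext_iff]

end Randomized

/-! ### A minimax principle -/

/-- If finitely many convex functions are never negative at the same time, then some convex
combination of them is nonnegative. -/
theorem exists_nonneg_convex_combination {E I : Type*} [AddCommGroup E] [Module ℝ E] [Fintype I]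
    {K : Set E} (hne : K.Nonempty) {f : I → E → ℝ} (hf : ∀ i, ConvexOn ℝ K (f i))
    (h : ∀ x ∈ K, ∃ i, 0 ≤ f i x) :
    ∃ w ∈ stdSimplex ℝ I, ∀ x ∈ K, 0 ≤ ∑ i, w i * f i x := by
  classical
  -- The vectors strictly above some `(f i x)` form an open convex set. By `h` it misses the origin,
  -- so a hyperplane separates the two.
  let C : Set (I → ℝ) := {y | ∃ x ∈ K, ∀ i, f i x < y i}
  obtain ⟨x₀, hx₀⟩ := hne
  have : Nonempty I := ⟨(h x₀ hx₀).choose⟩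
  have hCc : Convex ℝ C := by
    rintro y ⟨x, hx, hxy⟩ y' ⟨x', hx', hxy'⟩ a b ha hb hab
    refine ⟨a • x + b • x', (hf this.some).1 hx hx' ha hb hab, fun i => ?_⟩
    refine ((hf i).2 hx hx' ha hb hab).trans_lt ?_
    simp only [smul_eq_mul, Pi.add_apply, Pi.smul_apply]
    rcases ha.eq_or_lt with rfl | ha
    · have : b = 1 := by linarith
      subst this
      simpa using hxy' i
    · exact add_lt_add_of_lt_of_le (mul_lt_mul_of_pos_left (hxy i) ha)
        (mul_le_mul_of_nonneg_left (hxy' i).le hb)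
  have hCo : IsOpen C := by
    have : C = ⋃ x ∈ K, ⋂ i, {y : I → ℝ | f i x < y i} := by ext; simp [C]
    rw [this]
    exact isOpen_biUnion fun x _ => isOpen_iInter_of_finite fun i =>
      isOpen_lt continuous_const (continuous_apply i)
  have h0 : (0 : I → ℝ) ∉ C := by
    rintro ⟨x, hx, hlt⟩
    obtain ⟨i, hi⟩ := h x hx
    exact (hlt i).not_ge hi
  obtain ⟨φ, hφ⟩ := geometric_hahn_banach_open_point hCc hCo h0
  simp only [map_zero] at hφ
  let a : I → ℝ := fun i => -φ (Pi.single i 1)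
  have hφa : ∀ y : I → ℝ, φ y = -∑ i, a i * y i := by
    intro y
    have : y = ∑ i, y i • (Pi.single i 1 : I → ℝ) := by
      funext j
      simp [Finset.sum_apply, Pi.single_apply]
    conv_lhs => rw [this]
    simp [a, mul_comm]
  have hmem : ∀ x ∈ K, ∀ u : I → ℝ, (∀ i, 0 < u i) → 0 < ∑ i, a i * (f i x + u i) := by
    intro x hx u hu
    have := hφ (fun i => f i x + u i) ⟨x, hx, fun i => by linarith [hu i]⟩
    rw [hφa] at this
    linarith
  -- Coordinates may be increased freely within `C`, so a negative coefficient would eventually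
  -- violate the separation.
  have ha0 : ∀ i, 0 ≤ a i := by
    intro i
    by_contra! hi
    set S := ∑ j, a j * (f j x₀ + 1)
    have := hmem x₀ hx₀ (fun j => 1 + (Pi.single i (|S| / -a i) : I → ℝ) j) fun j => by
      have : 0 ≤ (Pi.single i (|S| / -a i) : I → ℝ) j := by
        rw [Pi.single_apply]
        split
        · exact div_nonneg (abs_nonneg _) (by linarith)
        · exact le_rfl
      linarith
    simp_rw [← add_assoc, mul_add _ (f _ x₀ + 1), Finset.sum_add_distrib] at this
    have e : ∑ j, a j * (Pi.single i (|S| / -a i) : I → ℝ) j = -|S| := by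
      simp only [Pi.single_apply, mul_ite, mul_zero, Finset.sum_ite_eq', Finset.mem_univ, if_true]
      rw [div_neg, mul_neg, mul_div_cancel₀ _ hi.ne]
    rw [e] at this
    linarith [le_abs_self S]
  have hA : 0 < ∑ i, a i := by
    refine (Finset.sum_nonneg fun i _ => ha0 i).lt_of_ne fun hA => ?_
    have hz := (Finset.sum_eq_zero_iff_of_nonneg fun i _ => ha0 i).1 hA.symm
    have := hmem x₀ hx₀ (fun _ => 1) fun _ => one_pos
    rw [Finset.sum_eq_zero fun i hi => by rw [hz i hi, zero_mul]] at this
    exact this.false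
  refine ⟨fun i => (∑ i, a i)⁻¹ * a i, ⟨fun i => mul_nonneg (by positivity) (ha0 i), ?_⟩,
    fun x hx => ?_⟩
  · rw [← Finset.mul_sum, inv_mul_cancel₀ hA.ne']
  · simp_rw [mul_assoc]
    rw [← Finset.mul_sum]
    -- Points of `C` lie strictly above `(f i x)`; the slack is made arbitrarily small.
    refine mul_nonneg (by positivity) (le_of_forall_pos_lt_add fun δ hδ => ?_)
    have := hmem x hx (fun _ => δ / ∑ i, a i) fun _ => by positivity
    simp_rw [mul_add] at this
    rw [Finset.sum_add_distrib, ← Finset.sum_mul, mul_div_cancel₀ _ hA.ne'] at this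
    exact this

/-! ### Average min-entropy -/

section Entropy

variable {n m : ℕ} {P Q : BitStr n × BitStr m → ℝ} {k : ℝ}

/-- The probability of guessing `X` from `Z`. -/
noncomputable def guess (Q : BitStr n × BitStr m → ℝ) : ℝ := ∑ z, ⨆ x, Q (x, z)

theorem le_iSup_left (Q : BitStr n × BitStr m → ℝ) (x : BitStr n) (z : BitStr m) :
    Q (x, z) ≤ ⨆ x, Q (x, z) :=
  le_ciSup (f := fun x => Q (x, z)) (Set.finite_range _).bddAbove x

theorem margZ_nonneg (hQ : Q ∈ stdSimplex ℝ (BitStr n × BitStr m)) (z : BitStr m) :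
    0 ≤ margZ Q z :=
  Finset.sum_nonneg fun _ _ => hQ.1 _

theorem sum_margZ (hQ : Q ∈ stdSimplex ℝ (BitStr n × BitStr m)) : ∑ z, margZ Q z = 1 := by
  rw [← hQ.2, Fintype.sum_prod_type_right]
  rfl

theorem margZ_le_mul_iSup (Q : BitStr n × BitStr m → ℝ) (z : BitStr m) :
    margZ Q z ≤ 2 ^ n * ⨆ x, Q (x, z) := by
  refine (Finset.sum_le_sum fun x _ => le_iSup_left Q x z).trans ?_
  simp

theorem one_le_mul_guess (hQ : Q ∈ stdSimplex ℝ (BitStr n × BitStr m)) : 1 ≤ 2 ^ n * guess Q := by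
  rw [← sum_margZ hQ, guess, Finset.mul_sum]
  exact Finset.sum_le_sum fun z _ => margZ_le_mul_iSup Q z

/-- The normalization by the marginal cancels, also where the marginal vanishes, since `Q` is then
zero there and so is the quotient. The logarithm can be inverted because `guess Q` is positive,
being at least `2^(-n)`. High entropy thus becomes a bound on a convex function. -/
theorem le_avgMinEntropy_iff (hQ : Q ∈ stdSimplex ℝ (BitStr n × BitStr m)) :
    k ≤ avgMinEntropy Q ↔ guess Q ≤ (2 : ℝ) ^ (-k) := by
  have h1 : ∑ z, margZ Q z * ⨆ x, Q (x, z) / margZ Q z = guess Q := by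
    refine Finset.sum_congr rfl fun z _ => ?_
    rcases (margZ_nonneg hQ z).eq_or_lt with h | h
    · have h2 : ∀ x, Q (x, z) = 0 := fun x =>
        (Finset.sum_eq_zero_iff_of_nonneg fun x _ => hQ.1 (x, z)).1 h.symm x (Finset.mem_univ x)
      simp [h2]
    · rw [Real.mul_iSup_of_nonneg h.le]
      exact congrArg _ (funext fun x => mul_div_cancel₀ _ h.ne')
  have h2 : 0 < guess Q := by
    have := one_le_mul_guess hQ
    by_contra! h
    nlinarith [pow_pos (two_pos (α := ℝ)) n]
  rw [avgMinEntropy, h1, le_neg, Real.logb_le_iff_le_rpow one_lt_two h2]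

theorem convex_isPairWithSameZ (P : BitStr n × BitStr m → ℝ) :
    Convex ℝ {Q | IsPairWithSameZ P Q} := by
  intro Q hQ Q' hQ' a b ha hb hab
  refine ⟨convex_stdSimplex ℝ _ hQ.1 hQ'.1 ha hb hab, fun z => ?_⟩
  have h1 := hQ.2 z
  have h2 := hQ'.2 z
  unfold margZ at h1 h2 ⊢
  simp only [Pi.add_apply, Pi.smul_apply, smul_eq_mul, Finset.sum_add_distrib, ← Finset.mul_sum,
    h1, h2]
  rw [← add_mul, hab, one_mul]

theorem convexOn_guess : ConvexOn ℝ Set.univ (guess : (BitStr n × BitStr m → ℝ) → ℝ) := by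
  refine ⟨convex_univ, fun Q _ Q' _ a b ha hb _ => ?_⟩
  simp only [guess, smul_eq_mul, Finset.mul_sum, ← Finset.sum_add_distrib]
  refine Finset.sum_le_sum fun z _ => ciSup_le fun x => ?_
  exact add_le_add (mul_le_mul_of_nonneg_left (le_iSup_left Q x z) ha)
    (mul_le_mul_of_nonneg_left (le_iSup_left Q' x z) hb)

theorem expect_linear (f : BitStr n × BitStr m → ℝ) (a b : ℝ) (Q Q' : BitStr n × BitStr m → ℝ) :
    expect (a • Q + b • Q') f = a * expect Q f + b * expect Q' f := by
  simp only [expect, Finset.mul_sum, ← Finset.sum_add_distrib]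
  exact Finset.sum_congr rfl fun w _ => by simp; ring

theorem expect_mono (hQ : Q ∈ stdSimplex ℝ (BitStr n × BitStr m)) {f f' : BitStr n × BitStr m → ℝ}
    (h : ∀ w, f w ≤ f' w) : expect Q f ≤ expect Q f' :=
  Finset.sum_le_sum fun w _ => mul_le_mul_of_nonneg_left (h w) (hQ.1 w)

theorem expect_const (hQ : Q ∈ stdSimplex ℝ (BitStr n × BitStr m)) (c : ℝ) :
    expect Q (fun _ => c) = c := by
  rw [expect, ← Finset.sum_mul, hQ.2, one_mul]

theorem expect_fun_snd (hQ : IsPairWithSameZ P Q) (f : BitStr m → ℝ) :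
    expect Q (fun w => f w.2) = ∑ z, margZ P z * f z := by
  rw [expect, Fintype.sum_prod_type_right]
  refine Finset.sum_congr rfl fun z _ => ?_
  rw [← hQ.2 z, margZ, Finset.sum_mul]

/-- The law of `(U, Z)` with `U` uniform and independent of `Z`. -/
noncomputable def uniformPair (P : BitStr n × BitStr m → ℝ) (w : BitStr n × BitStr m) : ℝ :=
  margZ P w.2 / 2 ^ n

theorem isPairWithSameZ_uniformPair (hP : P ∈ stdSimplex ℝ (BitStr n × BitStr m)) :
    IsPairWithSameZ P (uniformPair P) := by
  have h : ∀ z, margZ (uniformPair P) z = margZ P z := fun z => by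
    simp [margZ, uniformPair, mul_div_cancel₀]
  refine ⟨⟨fun w => div_nonneg (margZ_nonneg hP _) (by positivity), ?_⟩, h⟩
  rw [Fintype.sum_prod_type_right, ← sum_margZ hP]
  exact Finset.sum_congr rfl fun z _ => h z

theorem guess_uniformPair (hP : P ∈ stdSimplex ℝ (BitStr n × BitStr m)) :
    guess (uniformPair P) = 1 / 2 ^ n := by
  simp [guess, uniformPair, ← Finset.sum_div, sum_margZ hP]

theorem one_div_two_pow_le (hk : k ≤ n) : 1 / 2 ^ n ≤ (2 : ℝ) ^ (-k) := by
  rw [one_div, ← Real.rpow_natCast, ← Real.rpow_neg two_pos.le]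
  exact Real.rpow_le_rpow_of_exponent_le one_le_two (by linarith)

/-- For each `z`, no mass of `Q` exceeds the uniform mass by more than the maximal one does. This
makes a violated entropy constraint cost a bounded rate, and so bounds the multiplier below. -/
theorem expect_sub_expect_uniformPair_le (hP : P ∈ stdSimplex ℝ (BitStr n × BitStr m))
    (hQ : IsPairWithSameZ P Q) {F : BitStr n × BitStr m → ℝ} {a b : ℝ} (ha : ∀ w, a ≤ F w)
    (hb : ∀ w, F w ≤ b) :
    expect Q F - expect (uniformPair P) F ≤ 2 ^ n * (b - a) * (guess Q - 1 / 2 ^ n) := by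
  have hU := isPairWithSameZ_uniformPair hP
  have h1 : ∀ R, IsPairWithSameZ P R → expect R F = expect R (fun w => F w - a) + a := by
    intro R hR
    have : expect R (fun w => F w - a) = expect R F - a := by
      simp only [expect, mul_sub, Finset.sum_sub_distrib, ← Finset.sum_mul, hR.1.2, one_mul]
    linarith
  rw [h1 Q hQ, h1 _ hU, ← guess_uniformPair hP, add_sub_add_right_eq_sub]
  simp only [expect, guess, ← Finset.sum_sub_distrib, ← sub_mul, Finset.mul_sum]
  rw [Fintype.sum_prod_type_right]
  refine Finset.sum_le_sum fun z _ => ?_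
  have h2 : ∀ x, (Q (x, z) - uniformPair P (x, z)) * (F (x, z) - a) ≤
      ((⨆ x, Q (x, z)) - margZ P z / 2 ^ n) * (b - a) := by
    intro x
    have h3 : margZ P z / 2 ^ n ≤ ⨆ x, Q (x, z) := by
      rw [div_le_iff₀' (by positivity), ← hQ.2]
      exact margZ_le_mul_iSup Q z
    have h4 := le_iSup_left Q x z
    refine (mul_le_mul_of_nonneg_right (sub_le_sub_right h4 _) (sub_nonneg.2 (ha _))).trans
      (mul_le_mul_of_nonneg_left (sub_le_sub_right (hb _) _) (sub_nonneg.2 h3))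
  refine (Finset.sum_le_sum fun x _ => h2 x).trans (le_of_eq ?_)
  simp [uniformPair]
  ring

/-- Lagrange duality for maximizing an expectation over the laws of high average min-entropy. -/
theorem exists_multiplier (hP : P ∈ stdSimplex ℝ (BitStr n × BitStr m)) (hk : k ≤ n)
    {F : BitStr n × BitStr m → ℝ} {a b v : ℝ} (ha : ∀ w, a ≤ F w) (hb : ∀ w, F w ≤ b)
    (hv : ∀ Q, IsPairWithSameZ P Q → guess Q ≤ (2 : ℝ) ^ (-k) → expect Q F ≤ v) :
    ∃ l, 0 ≤ l ∧ l ≤ 2 ^ n * (b - a) ∧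
      ∀ Q, IsPairWithSameZ P Q → expect Q F ≤ v + l * (guess Q - (2 : ℝ) ^ (-k)) := by
  have hU := isPairWithSameZ_uniformPair hP
  set Λ := 2 ^ n * (b - a)
  have hΛ : 0 ≤ Λ := mul_nonneg (by positivity)
    (sub_nonneg.2 ((ha (fun _ => true, fun _ => true)).trans (hb _)))
  set κ := (2 : ℝ) ^ (-k)
  have hκ : 1 / 2 ^ n ≤ κ := one_div_two_pow_le hk
  -- The minimax principle is applied to the two extreme multipliers `0` and `Λ`; a convex
  -- combination of them is the desired multiplier.
  have hconv : ∀ i : Fin 2, ConvexOn ℝ {Q | IsPairWithSameZ P Q} fun Q =>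
      v - expect Q F + (if i = 0 then 0 else Λ) * (guess Q - κ) := by
    intro i
    refine ⟨convex_isPairWithSameZ P, fun Q _ Q' _ s t hs ht hst => ?_⟩
    have h1 := convexOn_guess.2 (Set.mem_univ Q) (Set.mem_univ Q') hs ht hst
    have h2 : (0 : ℝ) ≤ if i = 0 then 0 else Λ := by split <;> simp [hΛ]
    simp only [smul_eq_mul, expect_linear] at h1 ⊢
    generalize (if i = 0 then 0 else Λ) = c at h2 ⊢
    have h3 := mul_le_mul_of_nonneg_left h1 h2
    have h4 : (s + t) * (v - c * κ) = v - c * κ := by rw [hst, one_mul]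
    linarith
  have hpos : ∀ Q ∈ {Q | IsPairWithSameZ P Q}, ∃ i : Fin 2,
      0 ≤ v - expect Q F + (if i = 0 then 0 else Λ) * (guess Q - κ) := by
    intro Q hQ
    rcases le_or_gt (guess Q) κ with h | h
    · exact ⟨0, by simpa using hv Q hQ h⟩
    · refine ⟨1, ?_⟩
      simp only [Fin.isValue, one_ne_zero, if_false]
      have h0 : 0 < guess Q - 1 / 2 ^ n := by linarith
      -- Mixing in this share of the uniform law brings the guessing probability down to `κ` and
      -- costs at most `Λ * (guess Q - κ)` in expectation.
      set α := (guess Q - κ) / (guess Q - 1 / 2 ^ n) with hα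
      have hα0 : 0 ≤ α := div_nonneg (by linarith) h0.le
      have hα1 : α ≤ 1 := (div_le_one h0).2 (by linarith)
      have hαe : α * (guess Q - 1 / 2 ^ n) = guess Q - κ := div_mul_cancel₀ _ h0.ne'
      have h1 := hv ((1 - α) • Q + α • uniformPair P)
        (convex_isPairWithSameZ P hQ hU (by linarith) hα0 (by ring)) ?_
      · rw [expect_linear] at h1
        have h2 := mul_le_mul_of_nonneg_left (expect_sub_expect_uniformPair_le hP hQ ha hb) hα0
        have h3 : α * (Λ * (guess Q - 1 / 2 ^ n)) = Λ * (guess Q - κ) := by rw [← hαe]; ring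
        linarith
      · refine (convexOn_guess.2 (Set.mem_univ _) (Set.mem_univ _) (by linarith) hα0
          (by ring)).trans ?_
        rw [guess_uniformPair hP, smul_eq_mul, smul_eq_mul]
        linarith
  obtain ⟨w, hw, H⟩ := exists_nonneg_convex_combination (K := {Q | IsPairWithSameZ P Q})
    (f := fun (i : Fin 2) Q => v - expect Q F + (if i = 0 then 0 else Λ) * (guess Q - κ))
    ⟨_, hU⟩ hconv hpos
  refine ⟨w 1 * Λ, mul_nonneg (hw.1 1) hΛ, ?_, fun Q hQ => ?_⟩
  · exact mul_le_of_le_one_left hΛ (by have := hw.2; have := hw.1 0; simp at *; linarith)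
  · have h1 := H Q hQ
    have h2 := hw.2
    simp only [Fin.sum_univ_two, Fin.isValue, if_true, one_ne_zero, if_false] at h1 h2
    rw [eq_sub_of_add_eq h2] at h1
    linarith

/-- The law that is optimal against `F` is characterized by thresholds. -/
theorem exists_thresholds (hP : P ∈ stdSimplex ℝ (BitStr n × BitStr m)) (hk : k ≤ n)
    {F : BitStr n × BitStr m → ℕ} {G : ℕ} {v : ℝ} (hG : 0 < G) (ha : ∀ w, G ≤ 2 * F w)
    (hb : ∀ w, F w ≤ G)
    (hv : ∀ Q, IsPairWithSameZ P Q → guess Q ≤ (2 : ℝ) ^ (-k) → expect Q (fun w => (F w : ℝ)) ≤ v) :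
    ∃ (M : ℝ) (τ : BitStr m → ℕ), 0 ≤ M ∧ M ≤ 1 / 2 ∧
      (∀ z, ∑ x, ((F (x, z) - τ z : ℕ) : ℝ) ≤ 2 ^ n * G * M) ∧
      ∑ z, margZ P z * τ z + 2 ^ n * G * M * (2 : ℝ) ^ (-k) ≤ v + 1 := by
  have ha' : ∀ w, (G / 2 : ℝ) ≤ F w := fun w => by
    have : (G : ℝ) ≤ 2 * F w := by exact_mod_cast ha w
    linarith
  obtain ⟨l, hl0, hl1, H⟩ := exists_multiplier hP hk ha' (fun w => Nat.cast_le.2 (hb w)) hv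
  have hG' : (0 : ℝ) < G := by exact_mod_cast hG
  have hex : ∀ z, ∃ t : ℕ, ∑ x, ((F (x, z) - t : ℕ) : ℝ) ≤ l := fun z =>
    ⟨G, by simpa [Nat.sub_eq_zero_of_le (hb _)] using hl0⟩
  classical
  -- The least integer level over which the total excess of `F` is at most `l`.
  let τ : BitStr m → ℕ := fun z => Nat.find (hex z)
  have hlM : 2 ^ n * G * (l / (2 ^ n * G)) = l := mul_div_cancel₀ _ (by positivity)
  refine ⟨l / (2 ^ n * G), τ, by positivity, ?_, fun z => ?_, ?_⟩
  · rw [div_le_iff₀ (by positivity)]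
    linarith
  · rw [hlM]
    exact Nat.find_spec (hex z)
  rw [hlM]
  -- The dual inequality will be tested on the law that, given `z`, is uniform on the strings where
  -- `F` reaches the threshold.
  let S : BitStr m → Finset (BitStr n) := fun z => Finset.univ.filter fun x => τ z ≤ F (x, z)
  -- By minimality the excess over `τ z - 1` is above `l`. If `τ z = 0` there is no smaller level,
  -- and `G ≤ 2 * F` together with the bound on `l` takes over.
  have hS : ∀ z, l ≤ ∑ x ∈ S z, ((F (x, z) : ℝ) - (τ z - 1)) ∧ (S z).Nonempty := by
    intro z
    rcases Nat.eq_zero_or_pos (τ z) with h | h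
    · have hSz : S z = Finset.univ := by simp [S, h]
      rw [hSz, h]
      refine ⟨hl1.trans ?_, Finset.univ_nonempty⟩
      have : ∑ x : BitStr n, (G / 2 : ℝ) ≤ ∑ x, ((F (x, z) : ℝ) - ((0 : ℕ) - 1)) :=
        Finset.sum_le_sum fun x _ => by have := ha' (x, z); push_cast; linarith
      refine le_trans (le_of_eq ?_) this
      simp
      ring
    · have h1 := Nat.find_min (hex z) (m := τ z - 1) (by change _ < τ z; omega)
      rw [not_le] at h1
      have h2 : ∑ x, ((F (x, z) - (τ z - 1) : ℕ) : ℝ) =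
          ∑ x ∈ S z, ((F (x, z) : ℝ) - (τ z - 1)) := by
        rw [Finset.sum_filter]
        refine Finset.sum_congr rfl fun x _ => ?_
        split_ifs with hx
        · rw [Nat.cast_sub (by omega), Nat.cast_sub (by omega)]
          simp
        · rw [Nat.sub_eq_zero_of_le (by omega), Nat.cast_zero]
      rw [h2] at h1
      refine ⟨h1.le, Finset.nonempty_iff_ne_empty.2 fun h3 => ?_⟩
      rw [h3, Finset.sum_empty] at h1
      linarith
  have hc : ∀ z, (0 : ℝ) < (S z).card := fun z => by exact_mod_cast (hS z).2.card_pos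
  let Q : BitStr n × BitStr m → ℝ := fun w => if w.1 ∈ S w.2 then margZ P w.2 / (S w.2).card else 0
  have hQ0 : ∀ w, 0 ≤ Q w := fun w => by
    simp only [Q]
    split
    · exact div_nonneg (margZ_nonneg hP _) (hc _).le
    · exact le_rfl
  have hQz : ∀ z, margZ Q z = margZ P z := fun z => by
    have : margZ Q z = ∑ x ∈ S z, margZ P z / (S z).card := by simp [margZ, Q]
    rw [this, Finset.sum_const, nsmul_eq_mul, mul_div_cancel₀ _ (hc z).ne']
  have hQ : IsPairWithSameZ P Q := by
    refine ⟨⟨hQ0, ?_⟩, hQz⟩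
    rw [Fintype.sum_prod_type_right, ← sum_margZ hP]
    exact Finset.sum_congr rfl fun z _ => hQz z
  have hg : guess Q ≤ ∑ z, margZ P z / (S z).card := by
    refine Finset.sum_le_sum fun z _ => ciSup_le fun x => ?_
    simp only [Q]
    split
    · exact le_rfl
    · exact div_nonneg (margZ_nonneg hP _) (hc _).le
  have hE : expect Q (fun w => (F w : ℝ)) =
      ∑ z, margZ P z / (S z).card * ∑ x ∈ S z, (F (x, z) : ℝ) := by
    rw [expect, Fintype.sum_prod_type_right]
    refine Finset.sum_congr rfl fun z _ => ?_
    simp [Q, Finset.mul_sum]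
  have h1 := H Q hQ
  -- The final `1` pays for replacing the level `τ z - 1` by `τ z`.
  have h2 : ∑ z, margZ P z * τ z ≤ expect Q (fun w => (F w : ℝ)) -
      l * ∑ z, margZ P z / (S z).card + 1 := by
    rw [hE, Finset.mul_sum, ← Finset.sum_sub_distrib, ← sum_margZ hP, ← Finset.sum_add_distrib]
    refine Finset.sum_le_sum fun z _ => ?_
    have h3 := (hS z).1
    rw [Finset.sum_sub_distrib, Finset.sum_const, nsmul_eq_mul] at h3
    have h4 := mul_le_mul_of_nonneg_left h3 (div_nonneg (margZ_nonneg hP z) (hc z).le)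
    have h5 : margZ P z / (S z).card * ((S z).card * ((τ z : ℝ) - 1)) =
        margZ P z * (τ z - 1) := by
      field_simp [(hc z).ne']
    rw [mul_sub, h5] at h4
    linarith
  have h3 := mul_le_mul_of_nonneg_left hg hl0
  linarith

end Entropy

/-! ### Sampling in proportion to the excess over a threshold -/

section Predictor

variable {ι κ : Type} {g h ℓ : ℕ}

/-- Turns an excess into a probability: truncated subtraction counts the levels in `[b, a)`. -/
theorem expect_num_interval (ℓ : ℕ) {a : ℕ} (b : ℕ) (ha : a ≤ 2 ^ ℓ) :
    𝔼 t : Fin ℓ → Bool, ((decide (num t < a) && !decide (num t < b)).toNat : ℝ) =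
      ((a - b : ℕ) : ℝ) / 2 ^ ℓ := by
  rw [Fintype.expect_eq_sum_div_card,
    sum_num fun j => ((decide (j < a) && !decide (j < b)).toNat : ℝ)]
  congr 1
  · have h1 : ∀ j, ((decide (j < a) && !decide (j < b)).toNat : ℝ) =
        if j ∈ Finset.Ico b a then 1 else 0 := fun j => by
      by_cases h1 : j < a <;> by_cases h2 : j < b <;> simp [h1, h2]
    simp_rw [h1]
    rw [Finset.sum_ite_mem, Finset.inter_eq_right.2]
    · simp
    · intro j hj
      rw [Finset.mem_Ico] at hj
      exact Finset.mem_range.2 (by omega)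
  · simp

/-- Rejection sampling with a random level `t`: a candidate should be accepted if `τ z ≤ t < N`. The
circuit does not know `τ`; instead it tests by sampling whether the mean excess over `t` is at most
`M`. This holds whenever `τ z ≤ t`, so only a factor `1 - ρ` of the excess is lost. Levels below `τ
z` may pass too, but the total acceptance probability stays at most `M + η + ρ`, which is all that
the geometric sum needs. -/
theorem exists_excess_sampler [Fintype κ] [DecidableEq κ] {N : (ι ⊕ κ → Bool) → ℕ}
    (hN : ∀ v, N v ≤ 2 ^ ℓ)
    (hD : Decides g fun v : (ι ⊕ κ) ⊕ Fin ℓ → Bool =>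
      decide (num (fun i => v (.inr i)) < N fun i => v (.inl i)))
    {M η ρ : ℝ} (hM : 0 ≤ M) (hη0 : 0 ≤ η) (hη1 : η ≤ 1) (hMηρ : M + η + ρ ≤ 1)
    (hh : Real.exp (-((2 : ℝ) ^ h * (η / 2) ^ 2 / 4)) ≤ ρ) {τ : (ι → Bool) → ℕ}
    (hτ : ∀ z, 𝔼 y : κ → Bool, ((N (Sum.elim z y) - τ z : ℕ) : ℝ) ≤ 2 ^ ℓ * M) (T : ℕ) :
    ∃ p : (ι → Bool) → (κ → Bool) → ℝ,
      Samples (T * (g + 2 ^ h * (g + 4 * ℓ + 19) + 1 + 3 * Fintype.card κ)) p ∧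
      ∀ z y, (1 - ρ) * (((N (Sum.elim z y) - τ z : ℕ) : ℝ) / 2 ^ ℓ) / 2 ^ Fintype.card κ *
        ∑ i ∈ Finset.range T, (1 - (M + η + ρ)) ^ i ≤ p z y := by
  have hρ0 : 0 < ρ := (Real.exp_pos _).trans_le hh
  -- The excess of `N` over a given number, as a probability.
  have hacc := hD.input (ι := ((ι ⊕ Fin ℓ) ⊕ κ) ⊕ Fin ℓ)
    (Sum.elim (Sum.elim (fun i => .inl (.inl (.inl i))) fun i => .inl (.inr i)) .inr)
  have hcmp := (computes_wires (fun i : Fin ℓ => (.inr i : ((ι ⊕ Fin ℓ) ⊕ κ) ⊕ Fin ℓ))).num_lt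
    (computes_wires fun i => (.inl (.inl (.inr i))))
  have hexc := (hacc.gate hcmp fun a b => a && !b).flips.randomize.randomize
  obtain ⟨r, hr, hr1, hr2⟩ := hexc.threshold (h := h) hM hη0 hη1 hh
  set φ : (ι → Bool) → (Fin ℓ → Bool) → ℝ := fun z t => 𝔼 y : κ → Bool, 𝔼 t' : Fin ℓ → Bool,
    ((decide (num t' < N (Sum.elim z y)) && !decide (num t' < num t)).toNat : ℝ) with hφ
  have hφe : ∀ z t, (𝔼 y : κ → Bool, 𝔼 t' : Fin ℓ → Bool,
      ((decide (num (fun i => Sum.elim (Sum.elim (Sum.elim z t) y) t' (Sum.elim (Sum.elim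
          (fun i => .inl (.inl (.inl i))) fun i => .inl (.inr i)) .inr (.inr i :
            (ι ⊕ κ) ⊕ Fin ℓ) : ((ι ⊕ Fin ℓ) ⊕ κ) ⊕ Fin ℓ)) < N (fun i =>
          Sum.elim (Sum.elim (Sum.elim z t) y) t' (Sum.elim (Sum.elim
          (fun i => .inl (.inl (.inl i))) fun i => .inl (.inr i)) .inr (.inl i :
            (ι ⊕ κ) ⊕ Fin ℓ) : ((ι ⊕ Fin ℓ) ⊕ κ) ⊕ Fin ℓ))) &&
        !decide (num (fun i => Sum.elim (Sum.elim (Sum.elim z t) y) t'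
          (.inr i : ((ι ⊕ Fin ℓ) ⊕ κ) ⊕ Fin ℓ)) <
          num (fun i => Sum.elim (Sum.elim (Sum.elim z t) y) t'
            (.inl (.inl (.inr i)) : ((ι ⊕ Fin ℓ) ⊕ κ) ⊕ Fin ℓ)))).toNat : ℝ)) = φ z t := by
    intro z t
    refine Finset.expect_congr rfl fun y _ => Finset.expect_congr rfl fun t' _ => ?_
    simp only [Sum.elim_inl, Sum.elim_inr]
    congr 6
    funext i
    cases i <;> rfl
  have hr1' : ∀ z t, φ z t ≤ M → 1 - ρ ≤ r (Sum.elim z t) := fun z t hz =>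
    hr1 _ ((hφe z t).trans_le hz)
  have hr2' : ∀ z t, M + η ≤ φ z t → r (Sum.elim z t) ≤ ρ := fun z t hz =>
    hr2 _ (hz.trans_eq (hφe z t).symm)
  have hr0 := hr.nonneg
  have hr3 := hr.le_one
  have hφN : ∀ z t, φ z t = 𝔼 y : κ → Bool, ((N (Sum.elim z y) - num t : ℕ) : ℝ) / 2 ^ ℓ :=
    fun z t => Finset.expect_congr rfl fun y _ => expect_num_interval ℓ _ (hN _)
  -- The acceptance probability of a candidate.
  have hW := (hD.and_flips (hr.input (ι := (ι ⊕ κ) ⊕ Fin ℓ)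
    (Sum.elim (fun i => .inl (.inl i)) .inr))).randomize
  set W : (ι ⊕ κ → Bool) → ℝ := fun v => 𝔼 t : Fin ℓ → Bool,
    ((decide (num t < N v)).toNat : ℝ) * r (Sum.elim (fun i => v (.inl i)) t) with hWd
  replace hW : Flips (g + 2 ^ h * (g + 4 * ℓ + 19) + 1) W := by
    convert hW.mono (le_of_eq ?_) using 1
    · funext v
      refine Finset.expect_congr rfl fun t _ => ?_
      simp only [Sum.elim_inl, Sum.elim_inr]
      congr 2
      funext i
      cases i <;> rfl
    · ring
  obtain ⟨p, hp, H⟩ := hW.rejection T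
  refine ⟨p, hp, fun z y => le_trans ?_ (H z y)⟩
  have hW1 : (1 - ρ) * (((N (Sum.elim z y) - τ z : ℕ) : ℝ) / 2 ^ ℓ) ≤ W (Sum.elim z y) := by
    rw [← expect_num_interval ℓ _ (hN _), Finset.mul_expect]
    refine Finset.expect_le_expect fun t _ => ?_
    change _ ≤ ((decide (num t < N (Sum.elim z y))).toNat : ℝ) * r (Sum.elim z t)
    by_cases h1 : num t < N (Sum.elim z y) <;> by_cases h2 : num t < τ z <;>
      simp only [h1, h2, decide_true, decide_false, Bool.not_true, Bool.not_false, Bool.and_true,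
        Bool.and_false, Bool.toNat_true, Bool.toNat_false, Nat.cast_zero, Nat.cast_one, mul_zero,
        zero_mul, mul_one, one_mul, le_refl]
    · exact hr0 _
    · refine hr1' z t ?_
      rw [hφN, ← Finset.expect_div, div_le_iff₀' (by positivity)]
      refine le_trans (Finset.expect_le_expect fun y _ => ?_) (hτ z)
      exact_mod_cast Nat.sub_le_sub_left (not_lt.1 h2) _
  have hW0 : 0 ≤ 𝔼 y', W (Sum.elim z y') := Finset.expect_nonneg fun y' _ => hW.nonneg _
  have hA : 𝔼 y', W (Sum.elim z y') ≤ M + η + ρ := by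
    have h1 : 𝔼 y', W (Sum.elim z y') = 𝔼 t : Fin ℓ → Bool, (𝔼 y : κ → Bool,
        ((decide (num t < N (Sum.elim z y))).toNat : ℝ)) * r (Sum.elim z t) := by
      simp_rw [Finset.expect_mul]
      exact Finset.expect_comm _ _ _
    set c : (Fin ℓ → Bool) → ℝ := fun t => 𝔼 y : κ → Bool,
      ((decide (num t < N (Sum.elim z y))).toNat : ℝ) with hc
    have hc0 : ∀ t, 0 ≤ c t := fun t => Finset.expect_nonneg fun y _ => Nat.cast_nonneg _
    have hc1 : ∀ t, c t ≤ 1 := fun t =>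
      Finset.expect_le Finset.univ_nonempty fun y _ => toNat_le_one _
    have h2 : ∀ t, c t * r (Sum.elim z t) ≤ c t * (if φ z t < M + η then 1 else 0) + ρ := by
      intro t
      split_ifs with h
      · have := mul_le_mul_of_nonneg_left (hr3 (Sum.elim z t)) (hc0 t)
        linarith
      · have := mul_le_mul (hc1 t) (hr2' z t (not_lt.1 h)) (hr0 _) zero_le_one
        linarith
    -- Let `t₀` be the least level with mean excess below `M + η`. Every draw counted on the left
    -- satisfies `t₀ ≤ t < N`, an event whose probability is exactly the mean excess over `t₀`.
    have h3 : 𝔼 t, c t * (if φ z t < M + η then 1 else 0) ≤ M + η := by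
      by_cases hne : ∃ t, φ z t < M + η
      · obtain ⟨t₀, ht₀, hmin⟩ := Finset.exists_min_image
          (Finset.univ.filter fun t => φ z t < M + η) num (by
            obtain ⟨t, ht⟩ := hne
            exact ⟨t, by simpa using ht⟩)
        rw [Finset.mem_filter] at ht₀
        refine le_trans ?_ ht₀.2.le
        rw [hφ]
        simp only
        rw [Finset.expect_comm]
        refine Finset.expect_le_expect fun t _ => ?_
        rw [hc, Finset.expect_mul]
        refine Finset.expect_le_expect fun y _ => ?_
        split_ifs with h
        · have h4 := hmin t (by simpa using h)
          rw [decide_eq_false (not_lt.2 h4)]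
          simp
        · simp
      · push Not at hne
        have : ∀ t, c t * (if φ z t < M + η then 1 else 0) = 0 := fun t => by
          rw [if_neg (hne t).not_gt, mul_zero]
        simp_rw [this]
        rw [Finset.expect_const_zero]
        linarith
    rw [h1]
    refine (Finset.expect_le_expect fun t _ => h2 t).trans ?_
    rw [Finset.expect_add_distrib, Fintype.expect_const]
    linarith
  have hsum : ∑ i ∈ Finset.range T, (1 - (M + η + ρ)) ^ i ≤
      ∑ i ∈ Finset.range T, (1 - 𝔼 y', W (Sum.elim z y')) ^ i :=
    Finset.sum_le_sum fun i _ => pow_le_pow_left₀ (by linarith) (by linarith) _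
  refine mul_le_mul (div_le_div_of_nonneg_right hW1 (by positivity)) hsum
    (Finset.sum_nonneg fun i _ => pow_nonneg (by linarith) _) ?_
  exact div_nonneg (hW.nonneg _) (by positivity)

/-- Completing a random bit string by independent coins. -/
theorem Samples.complete {o : ℕ} {J : Finset (Fin o)} {p : (ι → Bool) → (J → Bool) → ℝ}
    (hp : Samples g p) :
    Samples g fun z (x : Fin o → Bool) => p z (fun j => x j) / 2 ^ (o - J.card) := by
  obtain ⟨c, _, _, f, hf, H⟩ := hp
  have h1 := (hf.input (ι := ι ⊕ (c ⊕ {j // j ∉ J})) (Sum.map id .inl)).sumElim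
    (computes_wires fun j : {j // j ∉ J} => (.inr (.inr j) : ι ⊕ (c ⊕ {j // j ∉ J})))
  have h2 := h1.reindex fun j : Fin o => if h : j ∈ J then .inl ⟨j, h⟩ else .inr ⟨j, h⟩
  refine ⟨_, inferInstance, inferInstance, _, h2.mono (by omega), fun z x => ?_⟩
  rw [expect_sumArrow]
  have h3 : ∀ (a : c → Bool) (b : {j // j ∉ J} → Bool), same (fun j : Fin o =>
      Sum.elim (f fun i => Sum.elim z (Sum.elim a b) (Sum.map id .inl i : ι ⊕ (c ⊕ {j // j ∉ J})))
        (fun j => Sum.elim z (Sum.elim a b) (.inr (.inr j) : ι ⊕ (c ⊕ {j // j ∉ J})))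
        (if h : j ∈ J then .inl ⟨j, h⟩ else .inr ⟨j, h⟩)) x =
      same (f (Sum.elim z a)) (fun j => x j) * same b (fun j => x j) := by
    intro a b
    have : (fun i => Sum.elim z (Sum.elim a b) (Sum.map id .inl i : ι ⊕ (c ⊕ {j // j ∉ J}))) =
        Sum.elim z a := by
      funext i
      cases i <;> rfl
    rw [this]
    simp only [same, ← ite_and, mul_ite, mul_one, mul_zero]
    refine if_congr ?_ rfl rfl
    simp only [funext_iff, Sum.elim_inr]
    constructor
    · intro h
      refine ⟨fun j => ?_, fun j => ?_⟩
      · have := h j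
        rwa [dif_neg j.2] at this
      · have := h j
        rwa [dif_pos j.2] at this
    · rintro ⟨h1, h2⟩ j
      split_ifs with hj
      · exact h2 ⟨j, hj⟩
      · exact h1 ⟨j, hj⟩
  have h4 : ∀ b' : {j // j ∉ J} → Bool, 𝔼 b : {j // j ∉ J} → Bool, same b b' =
      1 / 2 ^ (o - J.card) := fun b' => by
    rw [Fintype.expect_eq_sum_div_card]
    simp [same]
  simp_rw [h3, ← Finset.mul_expect, h4, ← Finset.expect_mul, ← H]
  rw [mul_one_div]

theorem expect_restrict {o : ℕ} (J : Finset (Fin o)) (F : (J → Bool) → ℝ) :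
    𝔼 x : Fin o → Bool, F (fun j => x j) = 𝔼 y, F y := by
  have := Fintype.expect_equiv (Equiv.piEquivPiSubtypeProd (· ∈ J) fun _ : Fin o => Bool)
    (fun x => F fun j => x j) (fun w => F w.1) fun x => rfl
  rw [this, ← Finset.univ_product_univ, Finset.expect_product]
  simp

end Predictor

/-! ### Unpredictable laws have high average min-entropy in the eyes of one test -/

section Core

variable {n m : ℕ} {P Q' : BitStr n × BitStr m → ℝ} {k : ℝ}

/-- Let `A = M + ρ + ρ` and let `S` be the sum, so `A * S = 1 - (1 - A) ^ T`. The choice of `ρ`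
leaves `(1 - ρ) * (M * E + e) ≥ A * E + e / 2`, so the product is at least `E - E * (1 - A) ^ T + e
/ 2 * S`. As `S ≥ T * (1 - A) ^ T` and `T > 2 * E / e`, the last term outweighs the loss, with no
lower bound on `M`. -/
theorem lt_mul_geom_sum {E e ρ M : ℝ} {T : ℕ} (hE : 1 ≤ E) (he0 : 0 < e) (he1 : e ≤ 1)
    (hρ : ρ = e / (8 * E)) (hM0 : 0 ≤ M) (hM1 : M ≤ 1 / 2) (hT : 2 * E / e < T) :
    E < (1 - ρ) * (M * E + e) * ∑ i ∈ Finset.range T, (1 - (M + ρ + ρ)) ^ i := by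
  have hρ0 : 0 < ρ := by rw [hρ]; positivity
  have hρE : ρ * E = e / 8 := by rw [hρ]; field_simp
  have hρ1 : ρ ≤ 1 / 8 := by nlinarith
  set S := ∑ i ∈ Finset.range T, (1 - (M + ρ + ρ)) ^ i with hS
  set A := M + ρ + ρ with hA
  have hA1 : 0 < 1 - A := by linarith
  have h1 : A * S = 1 - (1 - A) ^ T := by
    have := mul_neg_geom_sum (1 - A) T
    rwa [sub_sub_cancel] at this
  have h2 : T * (1 - A) ^ T ≤ S := by
    have : ∑ i ∈ Finset.range T, (1 - A) ^ T ≤ S := Finset.sum_le_sum fun i hi =>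
      pow_le_pow_of_le_one hA1.le (by linarith) (Finset.mem_range.1 hi).le
    simpa using this
  have h3 : A * E + e / 2 ≤ (1 - ρ) * (M * E + e) := by
    have h4 : ρ * (M * E) ≤ e / 16 := by
      have : ρ * (M * E) = M * (ρ * E) := by ring
      rw [this, hρE]
      nlinarith
    have h5 : ρ * e ≤ e / 8 := by nlinarith
    have h6 : A * E = M * E + e / 4 := by rw [hA]; linarith
    linarith
  have h7 : 0 < (1 - A) ^ T := pow_pos hA1 T
  have hS0 : 0 ≤ S := le_trans (by positivity) h2
  refine lt_of_lt_of_le ?_ (mul_le_mul_of_nonneg_right h3 hS0)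
  have h8 : E < T * (e / 2) := by
    rw [div_lt_iff₀ he0] at hT
    linarith
  have h9 : (A * E + e / 2) * S = E - E * (1 - A) ^ T + e / 2 * S := by
    have : (A * E + e / 2) * S = E * (A * S) + e / 2 * S := by ring
    rw [this, h1]
    ring
  rw [h9]
  have h10 := mul_le_mul_of_nonneg_left h2 (half_pos he0).le
  have h11 := mul_lt_mul_of_pos_right h8 h7
  linarith

/-- If it failed, the dual thresholds would give an excess of mean at least `2 ^ ℓ * (M * E + e)`
under `Q'`, and sampling in proportion to the excess would predict better than `2^(-k)`. The
condition that `F` is at least half its bound yields `M ≤ 1 / 2`, so the rejection probability stays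
positive. Only the coordinates in `J` undergo rejection; the others are free coins, so the size does
not grow with `n`. -/
theorem exists_highEntropy_of_unpredictable (hP : P ∈ stdSimplex ℝ (BitStr n × BitStr m))
    (hk : k ≤ n) (hQ' : IsPairWithSameZ P Q') {F : BitStr n × BitStr m → ℕ} {ℓ : ℕ}
    (hF0 : ∀ w, 2 ^ ℓ ≤ 2 * F w) (hF1 : ∀ w, F w ≤ 2 ^ ℓ) {J : Finset (Fin n)}
    (hJ : ∀ x x' z, (∀ j ∈ J, x j = x' j) → F (x, z) = F (x', z)) {g : ℕ}
    (hD : Decides g fun v : (Fin n ⊕ Fin m) ⊕ Fin ℓ → Bool => decide (num (fun i => v (.inr i)) <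
      F (fun i => v (.inl (.inl i)), fun i => v (.inl (.inr i)))))
    {e ρ : ℝ} (he0 : 0 < e) (he1 : e ≤ 1) (hρ : ρ = e / (8 * (2 : ℝ) ^ (n - k))) {h T : ℕ}
    (hh : Real.exp (-((2 : ℝ) ^ h * (ρ / 2) ^ 2 / 4)) ≤ ρ) (hT : 2 * (2 : ℝ) ^ (n - k) / e < T)
    (hunp : ∀ C : ProbCircuit (Fin m) n,
      C.size ≤ T * (g + 2 ^ h * (g + 4 * ℓ + 19) + 1 + 3 * J.card) →
      expect Q' (fun w => C.prob w.2 w.1) ≤ (2 : ℝ) ^ (-k)) :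
    ∃ Q, IsPairWithSameZ P Q ∧ guess Q ≤ (2 : ℝ) ^ (-k) ∧
      expect Q' (fun w => (F w : ℝ)) ≤ expect Q (fun w => (F w : ℝ)) + 2 ^ ℓ * e + 1 := by
  by_contra! hcon
  set E := (2 : ℝ) ^ (n - k) with hE
  have hE1 : 1 ≤ E := Real.one_le_rpow one_le_two (by linarith)
  have hρ0 : 0 < ρ := by rw [hρ]; positivity
  have hρ1 : ρ ≤ 1 / 8 := by
    rw [hρ, div_le_iff₀ (by positivity)]
    linarith
  have hEk : 2 ^ n * (2 : ℝ) ^ (-k) = E := by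
    rw [hE, sub_eq_add_neg, Real.rpow_add two_pos, Real.rpow_natCast]
  obtain ⟨M, τ, hM0, hM1, hτ, hdual⟩ := exists_thresholds hP hk (G := 2 ^ ℓ) (by positivity) hF0 hF1
    (v := expect Q' (fun w => (F w : ℝ)) - 2 ^ ℓ * e - 1) fun Q hQ hg => by
      linarith [hcon Q hQ hg]
  -- Coordinates outside `J` do not affect `F` and are filled with constants.
  let N : (Fin m ⊕ J → Bool) → ℕ := fun v =>
    F (fun j => if h : j ∈ J then v (.inr ⟨j, h⟩) else false, fun i => v (.inl i))
  have hNF : ∀ x z, N (Sum.elim z fun j => x j) = F (x, z) := by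
    intro x z
    refine hJ _ _ _ fun j hj => ?_
    simp [hj]
  have hfill : Computes 0 fun (v : (Fin m ⊕ J) ⊕ Fin ℓ → Bool) (i : (Fin n ⊕ Fin m) ⊕ Fin ℓ) =>
      Sum.elim (Sum.elim (fun j => if h : j ∈ J then v (.inl (.inr ⟨j, h⟩)) else false)
        fun i => v (.inl (.inl i))) (fun i => v (.inr i)) i := by
    refine ⟨0, .nil, Sum.elim (Sum.elim (fun j => if h : j ∈ J then
      .input (.inl (.inr ⟨j, h⟩)) else .const false) fun i => .input (.inl (.inl i)))
      fun i => .input (.inr i), le_rfl, ?_⟩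
    rintro v ((j | i) | i)
    · by_cases h : j ∈ J <;> simp [h, Wire.val]
    · rfl
    · rfl
  have hND : Decides g fun v : (Fin m ⊕ J) ⊕ Fin ℓ → Bool =>
      decide (num (fun i => v (.inr i)) < N fun i => v (.inl i)) :=
    (hD.comp hfill).mono (by omega)
  obtain ⟨p, hp, H⟩ := exists_excess_sampler (h := h) (M := M) (N := N) (fun v => hF1 _) hND hM0 hρ0.le
    (by linarith) (by linarith) hh (τ := τ) (fun z => by
      rw [← expect_restrict J fun y => ((N (Sum.elim z y) - τ z : ℕ) : ℝ)]
      simp_rw [hNF]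
      rw [Fintype.expect_eq_sum_div_card, div_le_iff₀ (by positivity)]
      refine (hτ z).trans (le_of_eq ?_)
      simp
      ring) T
  obtain ⟨C, hC, hCp⟩ := hp.complete.exists_probCircuit
  have hC' := hunp C (hC.trans (by simp))
  set S := ∑ i ∈ Finset.range T, (1 - (M + ρ + ρ)) ^ i with hS
  have hJn : J.card ≤ n := by simpa using J.card_le_univ
  have hS0 : 0 ≤ S := Finset.sum_nonneg fun i _ => pow_nonneg (by linarith) _
  have hc0 : 0 ≤ (1 - ρ) * S / (2 ^ n * 2 ^ ℓ) :=
    div_nonneg (mul_nonneg (by linarith) hS0) (by positivity)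
  have h1 : ∀ w, (1 - ρ) * S / (2 ^ n * 2 ^ ℓ) * ((F w : ℝ) - τ w.2) ≤ C.prob w.2 w.1 := by
    rintro ⟨x, z⟩
    rw [hCp]
    have h2 := H z fun j => x j
    rw [hNF] at h2
    -- The truncated excess dominates the signed one, whose expectation splits linearly.
    have h3 : (F (x, z) : ℝ) - τ z ≤ (F (x, z) - τ z : ℕ) := by
      rw [sub_le_iff_le_add]
      exact_mod_cast le_tsub_add
    refine (mul_le_mul_of_nonneg_left h3 hc0).trans ?_
    refine le_trans (le_of_eq ?_) (div_le_div_of_nonneg_right h2 (by positivity))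
    have h4 : (2 : ℝ) ^ n = 2 ^ J.card * 2 ^ (n - J.card) := by
      rw [← pow_add, Nat.add_sub_cancel' hJn]
    rw [h4, Fintype.card_coe]
    field_simp
  have h2 := expect_mono hQ'.1 h1
  have h3 : expect Q' (fun w => (1 - ρ) * S / (2 ^ n * 2 ^ ℓ) * ((F w : ℝ) - τ w.2)) =
      (1 - ρ) * S / (2 ^ n * 2 ^ ℓ) *
        (expect Q' (fun w => (F w : ℝ)) - ∑ z, margZ P z * τ z) := by
    rw [← expect_fun_snd hQ' fun z => (τ z : ℝ)]
    simp only [expect, ← Finset.sum_sub_distrib, Finset.mul_sum]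
    exact Finset.sum_congr rfl fun w _ => by ring
  have h4 : 2 ^ ℓ * (M * E + e) ≤ expect Q' (fun w => (F w : ℝ)) - ∑ z, margZ P z * τ z := by
    have h5 : 2 ^ n * ((2 ^ ℓ : ℕ) : ℝ) * M * (2 : ℝ) ^ (-k) = 2 ^ ℓ * (M * E) := by
      rw [← hEk]
      push_cast
      ring
    rw [h5] at hdual
    linarith
  have h5 := lt_mul_geom_sum hE1 he0 he1 hρ hM0 hM1 hT
  have h6 := mul_le_mul_of_nonneg_left h4 hc0
  have h7 : (1 - ρ) * S / (2 ^ n * 2 ^ ℓ) * (2 ^ ℓ * (M * E + e)) =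
      (1 - ρ) * (M * E + e) * S / 2 ^ n := by
    field_simp
  have h8 : (2 : ℝ) ^ (-k) < (1 - ρ) * (M * E + e) * S / 2 ^ n := by
    rw [lt_div_iff₀ (by positivity), mul_comm, hEk]
    exact h5
  linarith

end Core

/-! ### Circuits with real-valued output -/

section RealValued

variable {ι κ : Type} {g : ℕ}

/-- Apart from the values of the gates, a wire depends on at most one input bit. -/
theorem Wire.exists_support [DecidableEq ι] (w : Wire ι g) :
    ∃ J : Finset ι, J.card ≤ 1 ∧ ∀ (x x' : ι → Bool) (v : Fin g → Bool), (∀ i ∈ J, x i = x' i) →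
      w.val x v = w.val x' v := by
  cases w with
  | const b => exact ⟨∅, by simp, fun x x' v _ => rfl⟩
  | input i => exact ⟨{i}, by simp, fun x x' v h => h i (by simp)⟩
  | gate j => exact ⟨∅, by simp, fun x x' v _ => rfl⟩

theorem Netlist.exists_support [DecidableEq ι] (N : Netlist ι g) :
    ∃ J : Finset ι, J.card ≤ 2 * g ∧ ∀ x x' : ι → Bool, (∀ i ∈ J, x i = x' i) →
      N.vals x = N.vals x' := by
  induction N with
  | nil => exact ⟨∅, by simp, fun x x' _ => funext fun j => j.elim0⟩
  | @snoc g N op a b ih =>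
    obtain ⟨J, hJ, H⟩ := ih
    obtain ⟨Ja, hJa, Ha⟩ := a.exists_support
    obtain ⟨Jb, hJb, Hb⟩ := b.exists_support
    refine ⟨J ∪ Ja ∪ Jb, ?_, fun x x' h => ?_⟩
    · have h1 := Finset.card_union_le (J ∪ Ja) Jb
      have h2 := Finset.card_union_le J Ja
      omega
    · simp only [Netlist.vals]
      rw [H x x' fun i hi => h i (by simp [hi]), Ha x x' _ fun i hi => h i (by simp [hi]),
        Hb x x' _ fun i hi => h i (by simp [hi])]

/-- A circuit depends on few input bits only. -/
theorem Computes.exists_support [DecidableEq ι] [Fintype κ] {f : (ι → Bool) → κ → Bool}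
    (hf : Computes g f) : ∃ J : Finset ι, J.card ≤ 2 * g + Fintype.card κ ∧
      ∀ x x' : ι → Bool, (∀ i ∈ J, x i = x' i) → f x = f x' := by
  obtain ⟨s, N, o, hs, H⟩ := hf
  obtain ⟨J, hJ, HJ⟩ := N.exists_support
  choose Jo hJo Ho using fun i => (o i).exists_support
  refine ⟨J ∪ Finset.univ.biUnion Jo, ?_, fun x x' h => funext fun i => ?_⟩
  · have h1 := Finset.card_union_le J (Finset.univ.biUnion Jo)
    have h2 := Finset.card_biUnion_le_card_mul Finset.univ Jo 1 fun i _ => hJo i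
    rw [Finset.card_univ, mul_one] at h2
    omega
  · rw [← H, ← H, HJ x x' fun j hj => h j (by simp [hj]), Ho i x x' _ fun j hj => h j (by
      simp only [Finset.mem_union, Finset.mem_biUnion, Finset.mem_univ, true_and]
      exact .inr ⟨i, hj⟩)]

theorem sum_Ico_one_half_pow_le (a b : ℕ) : ∑ j ∈ Finset.Ico a b, (1 / 2 : ℝ) ^ j ≤ 2 * (1 / 2) ^ a := by
  rcases le_total a b with hab | hab
  · rw [geom_sum_Ico (by norm_num) hab]
    have : (0 : ℝ) < (1 / 2) ^ b := by positivity
    rw [div_le_iff_of_neg (by norm_num)]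
    linarith
  · rw [Finset.Ico_eq_empty_of_le hab]
    simp

/-- The first digits of the output of a circuit, the least significant one first. -/
def Circuit.digits {p : ℕ} (D : Circuit ι (p + 1)) (L : ℕ) (x : ι → Bool) (i : Fin (L + 1)) :
    Bool :=
  if h : L - i < p + 1 then D.eval x ⟨L - i, h⟩ else false

theorem Circuit.computes_digits {p : ℕ} (D : Circuit ι (p + 1)) (L : ℕ) :
    Computes D.size (D.digits L) := by
  refine ⟨D.size, D.gates, fun i => if h : L - i < p + 1 then D.out ⟨L - i, h⟩ else .const false,
    le_rfl, fun x i => ?_⟩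
  by_cases h : L - i < p + 1
  · simp only [Circuit.digits, h, dif_pos]
    rfl
  · simp only [Circuit.digits, h, dif_neg, not_false_eq_true]
    rfl

/-- The digits dropped have weights `2^(-L-1), 2^(-L-2), …`, of total at most `2^(-L)`; absent
digits count as zero. -/
theorem Circuit.num_digits {p : ℕ} (D : Circuit ι (p + 1)) (L : ℕ) (x : ι → Bool) :
    (num (D.digits L x) : ℝ) / 2 ^ L ≤ D.realVal x ∧
      D.realVal x ≤ (num (D.digits L x) : ℝ) / 2 ^ L + 1 / 2 ^ L := by
  let u : ℕ → ℝ := fun j => if h : j < p + 1 then if D.eval x ⟨j, h⟩ then (1 / 2) ^ j else 0 else 0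
  have hu0 : ∀ j, 0 ≤ u j := fun j => by
    simp only [u]
    split_ifs <;> positivity
  have hu1 : ∀ j, u j ≤ (1 / 2) ^ j := fun j => by
    simp only [u]
    split_ifs <;> first | exact le_rfl | positivity
  have h1 : D.realVal x = ∑ j ∈ Finset.range (p + 1), u j := by
    rw [Finset.sum_range]
    exact Finset.sum_congr rfl fun i _ => by simp only [u, dif_pos i.2]
  have h2 : (num (D.digits L x) : ℝ) / 2 ^ L = ∑ j ∈ Finset.range (L + 1), u j := by
    rw [Finset.sum_range, ← Equiv.sum_comp Fin.revPerm, num, Nat.cast_sum, Finset.sum_div]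
    refine Finset.sum_congr rfl fun i _ => ?_
    have hi : (Fin.revPerm i : ℕ) = L - i := by simp [Fin.val_rev]
    have h3 : (2 : ℝ) ^ (i : ℕ) / 2 ^ L = (1 / 2) ^ (L - i : ℕ) := by
      rw [div_eq_iff (by positivity), one_div, inv_pow, inv_mul_eq_div, eq_div_iff (by positivity),
        ← pow_add, Nat.add_sub_cancel' (by omega)]
    simp only [u, hi, Circuit.digits]
    split_ifs <;> simp_all
  have h3 : ∑ j ∈ Finset.range (p + 1), u j =
      ∑ j ∈ Finset.range (max (p + 1) (L + 1)), u j := by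
    refine Finset.sum_subset (Finset.range_mono (le_max_left _ _)) fun j _ hj => ?_
    rw [Finset.mem_range] at hj
    simp only [u, dif_neg hj]
  have h4 := Finset.sum_range_add_sum_Ico u (le_max_right (p + 1) (L + 1))
  rw [h1, h2, h3, ← h4]
  refine ⟨le_add_of_nonneg_right (Finset.sum_nonneg fun j _ => hu0 j), ?_⟩
  refine add_le_add_right ((Finset.sum_le_sum fun j _ => hu1 j).trans
    ((sum_Ico_one_half_pow_le _ _).trans (le_of_eq ?_))) _
  rw [pow_succ, one_div_pow]
  ring

theorem num_not {ℓ : ℕ} (a : Fin ℓ → Bool) : num a + num (fun i => !a i) + 1 = 2 ^ ℓ := by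
  induction ℓ with
  | zero => simp [num]
  | succ ℓ ih =>
    have := ih fun i => a i.castSucc
    rw [num_succ, num_succ, pow_succ]
    cases a (Fin.last ℓ) <;> simp <;> omega

theorem num_lastCases_false {L : ℕ} (a : Fin L → Bool) :
    num (Fin.lastCases (motive := fun _ => Bool) false a) = num a := by
  rw [num_succ]
  simp

/-- Truncating the output of `D` and comparing it to a random number gives a Boolean test. -/
theorem Circuit.flips_digits {p : ℕ} (D : Circuit ι (p + 1)) {L : ℕ}
    (hL : ∀ x, num (D.digits L x) ≤ 2 ^ L) :
    Flips (D.size + 4 * (L + 1)) fun x => (num (D.digits L x) : ℝ) / 2 ^ L := by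
  have h1 : Computes 0 fun (v : ι ⊕ Fin L → Bool) =>
      Fin.lastCases (motive := fun _ => Bool) false fun i : Fin L => v (.inr i) := by
    refine ⟨0, .nil, Fin.lastCases (motive := fun _ => _) (.const false) fun i => .input (.inr i),
      le_rfl, fun v i => ?_⟩
    refine Fin.lastCases ?_ (fun i => ?_) i <;> simp [Wire.val]
  have h2 := (h1.num_lt ((D.computes_digits L).input Sum.inl)).flips.randomize
  convert h2.mono (le_of_eq ?_) using 1
  · funext x
    have := expect_num_interval L 0 (hL x)
    rw [Nat.sub_zero] at this
    rw [← this]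
    refine Finset.expect_congr rfl fun t _ => ?_
    have h3 := num_lastCases_false t
    change _ = ((decide (num (Fin.lastCases (motive := fun _ => Bool) false t) <
      num (D.digits L x))).toNat : ℝ)
    simp [h3]
  · ring

/-- Comparing a random number to `2 ^ L` plus the truncated output of `D`. -/
theorem Circuit.decides_lt_digits {p : ℕ} (D : Circuit ι (p + 1)) (L : ℕ) :
    Decides (D.size + 5 * (L + 1) + 3) fun v : ι ⊕ Fin (L + 1) → Bool =>
      decide (num (fun i => v (.inr i)) < 2 ^ L + num (D.digits L fun i => v (.inl i))) := by
  have h1 : Computes 0 fun (v : ι ⊕ Fin (L + 1) → Bool) =>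
      Fin.lastCases (motive := fun _ => Bool) false fun i : Fin L => v (.inr i.castSucc) := by
    refine ⟨0, .nil, Fin.lastCases (motive := fun _ => _) (.const false)
      fun i => .input (.inr i.castSucc), le_rfl, fun v i => ?_⟩
    refine Fin.lastCases ?_ (fun i => ?_) i <;> simp [Wire.val]
  have h2 := (decides_wire (.inr (Fin.last L))).gate
    (h1.num_lt ((D.computes_digits L).input Sum.inl)) fun a b => !a || b
  refine (h2.congr fun v => ?_).mono (by omega)
  rw [num_lastCases_false fun i => v (.inr i.castSucc), num_succ fun i => v (.inr i)]
  have h3 := num_lt fun i : Fin L => v (.inr i.castSucc)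
  rw [Bool.eq_iff_iff]
  cases v (.inr (Fin.last L))
  · simp
    omega
  · simp
    omega

/-- Comparing a random number to `2 ^ (L + 1)` minus the truncated output of `D`. -/
theorem Circuit.decides_lt_sub_digits {p : ℕ} (D : Circuit ι (p + 1)) {L : ℕ}
    (hL : ∀ x, num (D.digits L x) ≤ 2 ^ L) :
    Decides (D.size + 5 * (L + 1) + 3) fun v : ι ⊕ Fin (L + 1) → Bool =>
      decide (num (fun i => v (.inr i)) <
        2 ^ L + (2 ^ L - num (D.digits L fun i => v (.inl i)))) := by
  have h0 : Computes (L * 1) fun (v : ι ⊕ Fin (L + 1) → Bool) (i : Fin L) => !v (.inr i.castSucc) := by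
    simpa using computes_fintype fun i : Fin L =>
      (decides_wire (ι := ι ⊕ Fin (L + 1)) (.inr i.castSucc)).not
  have h1 := (h0.sumElim (decides_const false)).reindex
    (Fin.lastCases (motive := fun _ => Fin L ⊕ Unit) (.inr ()) .inl)
  -- A random number with top digit `0` is below `2 ^ L`. Otherwise, for its lower part `t` and the
  -- truncated output `d`, the condition `t < 2 ^ L - d` says that `2 ^ L - 1 - t < d` fails, and
  -- negating the digits of `t` produces `2 ^ L - 1 - t`.
  have h2 := (decides_wire (.inr (Fin.last L))).gate
    (h1.num_lt ((D.computes_digits L).input Sum.inl)) fun a b => !a || !b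
  refine (h2.congr fun v => ?_).mono (by omega)
  rw [num_succ fun i => v (.inr i), num_succ]
  have h3 := num_lt fun i : Fin L => v (.inr i.castSucc)
  have h4 := num_not fun i : Fin L => v (.inr i.castSucc)
  have h5 := hL fun i => v (.inl i)
  simp only [Fin.lastCases_last, Fin.lastCases_castSucc, Sum.elim_inl, Sum.elim_inr]
  rw [Bool.eq_iff_iff]
  cases v (.inr (Fin.last L))
  · simp
    omega
  · simp
    omega

end RealValued

/-! ### From unpredictability to metric entropy -/

section Metric

variable {n m : ℕ} {P Q' : BitStr n × BitStr m → ℝ} {k γ ε : ℝ}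

theorem expect_mul_add (hQ : Q' ∈ stdSimplex ℝ (BitStr n × BitStr m))
    (f : BitStr n × BitStr m → ℝ) (a b : ℝ) :
    expect Q' (fun w => a * f w + b) = a * expect Q' f + b := by
  have : expect Q' (fun _ => b) = b := expect_const hQ b
  rw [← this]
  simp only [expect, Finset.mul_sum, ← Finset.sum_add_distrib]
  exact Finset.sum_congr rfl fun w _ => by
    have := hQ.2
    rw [← Finset.sum_mul, this]
    ring

theorem expect_sum_mul {I : Type*} [Fintype I] (Q : BitStr n × BitStr m → ℝ) (c : I → ℝ)
    (f : I → BitStr n × BitStr m → ℝ) :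
    expect Q (fun w => ∑ i, c i * f i w) = ∑ i, c i * expect Q (f i) := by
  simp only [expect, Finset.mul_sum]
  rw [Finset.sum_comm]
  exact Finset.sum_congr rfl fun i _ => Finset.sum_congr rfl fun w _ => by ring

/-- Unless one of the two laws is already close enough, their expectations lie on opposite sides of
`c`, and a mixture, still of high entropy by convexity, meets `c` exactly. -/
theorem exists_abs_expect_sub_le {f : BitStr n × BitStr m → ℝ} {c η : ℝ} (hη : 0 ≤ η)
    {Q₁ Q₂ : BitStr n × BitStr m → ℝ} (h₁ : IsPairWithSameZ P Q₁ ∧ guess Q₁ ≤ (2 : ℝ) ^ (-k))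
    (h₂ : IsPairWithSameZ P Q₂ ∧ guess Q₂ ≤ (2 : ℝ) ^ (-k)) (hc₁ : c - η ≤ expect Q₁ f)
    (hc₂ : expect Q₂ f ≤ c + η) :
    ∃ Q, (IsPairWithSameZ P Q ∧ guess Q ≤ (2 : ℝ) ^ (-k)) ∧ |c - expect Q f| ≤ η := by
  by_cases h3 : expect Q₁ f ≤ c + η
  · exact ⟨Q₁, h₁, abs_le.2 ⟨by linarith, by linarith⟩⟩
  by_cases h4 : c - η ≤ expect Q₂ f
  · exact ⟨Q₂, h₂, abs_le.2 ⟨by linarith, by linarith⟩⟩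
  push Not at h3 h4
  have h0 : 0 < expect Q₁ f - expect Q₂ f := by linarith
  set s := (c - expect Q₂ f) / (expect Q₁ f - expect Q₂ f) with hs
  have hs0 : 0 ≤ s := div_nonneg (by linarith) h0.le
  have hs1 : s ≤ 1 := (div_le_one h0).2 (by linarith)
  have hse : s * (expect Q₁ f - expect Q₂ f) = c - expect Q₂ f := div_mul_cancel₀ _ h0.ne'
  refine ⟨s • Q₁ + (1 - s) • Q₂, ⟨convex_isPairWithSameZ P h₁.1 h₂.1 hs0 (by linarith) (by ring),
    ?_⟩, ?_⟩
  · refine (convexOn_guess.2 (Set.mem_univ _) (Set.mem_univ _) hs0 (by linarith) (by ring)).trans ?_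
    simp only [smul_eq_mul]
    have := mul_le_mul_of_nonneg_left h₁.2 hs0
    have := mul_le_mul_of_nonneg_left h₂.2 (sub_nonneg.2 hs1)
    linarith
  · rw [expect_linear]
    have : c - (s * expect Q₁ f + (1 - s) * expect Q₂ f) = 0 := by linarith
    rw [this, abs_zero]
    exact hη

/-- One deterministic test with real-valued output cannot tell an unpredictable law from all laws
of high average min-entropy. -/
theorem exists_highEntropy_of_realVal (hP : P ∈ stdSimplex ℝ (BitStr n × BitStr m)) (hk : k ≤ n)
    (hγ : 0 ≤ γ) (hQ' : IsPairWithSameZ P Q') {p : ℕ} (D : Circuit (Fin n ⊕ Fin m) (p + 1))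
    (hD : ∀ x, D.realVal x ≤ 1) (hε0 : 0 < ε) (hε1 : ε ≤ 1) {ρ : ℝ}
    (hρ : ρ = ε / 4 / (8 * (2 : ℝ) ^ (n - k))) {h T L s : ℕ}
    (hh : Real.exp (-((2 : ℝ) ^ h * (ρ / 2) ^ 2 / 4)) ≤ ρ)
    (hT : 2 * (2 : ℝ) ^ (n - k) / (ε / 4) < T) (hL : 4 / ε ≤ 2 ^ L)
    (hs : T * (D.size + 5 * (L + 1) + 3 + 2 ^ h * (D.size + 5 * (L + 1) + 3 + 4 * (L + 1) + 19) +
      1 + 3 * (2 * D.size + (L + 1))) ≤ s) (hs' : D.size + 4 * (L + 1) ≤ s)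
    (hind : Indist γ s P Q')
    (hunp : ∀ C : ProbCircuit (Fin m) n, (C.size : ℝ) ≤ s →
      expect Q' (fun w => C.prob w.2 w.1) ≤ (2 : ℝ) ^ (-k)) :
    ∃ Q, (IsPairWithSameZ P Q ∧ guess Q ≤ (2 : ℝ) ^ (-k)) ∧
      |expect P (fun w => D.realVal (pairInput w)) - expect Q (fun w => D.realVal (pairInput w))| ≤
        ε + γ := by
  have h2L : (0 : ℝ) < 2 ^ L := by positivity
  have hNle : ∀ x, num (D.digits L x) ≤ 2 ^ L := fun x => by
    have := (D.num_digits L x).1.trans (hD x)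
    rw [div_le_one h2L] at this
    exact_mod_cast this
  set f : BitStr n × BitStr m → ℝ := fun w => (num (D.digits L (pairInput w)) : ℝ) / 2 ^ L with hf
  have hL' : 1 / 2 ^ L ≤ ε / 4 := by
    rw [div_le_iff₀ h2L]
    rw [div_le_iff₀ hε0] at hL
    linarith
  have hDf : ∀ R ∈ stdSimplex ℝ (BitStr n × BitStr m),
      expect R f ≤ expect R (fun w => D.realVal (pairInput w)) ∧
        expect R (fun w => D.realVal (pairInput w)) ≤ expect R f + ε / 4 := by
    intro R hR
    refine ⟨expect_mono hR fun w => (D.num_digits L _).1, ?_⟩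
    have : expect R (fun w => 1 * f w + ε / 4) = expect R f + ε / 4 := by
      rw [expect_mul_add hR, one_mul]
    rw [← this]
    refine expect_mono hR fun w => (D.num_digits L _).2.trans ?_
    rw [one_mul]
    exact add_le_add_right hL' _
  have hPQ : |expect P f - expect Q' f| ≤ γ := by
    obtain ⟨C, hC, hp⟩ := (D.flips_digits hNle).exists_probCircuit
    have := hind C (by exact_mod_cast hC.trans hs')
    simpa only [hp] using this
  obtain ⟨J₀, hJ₀, HJ⟩ := (D.computes_digits L).exists_support
  rw [Fintype.card_fin] at hJ₀
  have hJ : ∀ x x' z, (∀ j ∈ J₀.toLeft, x j = x' j) →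
      D.digits L (pairInput (x, z)) = D.digits L (pairInput (x', z)) := by
    intro x x' z hx
    refine HJ _ _ ?_
    rintro (j | i) hj
    · exact hx j (by simpa using hj)
    · rfl
  have hJc : J₀.toLeft.card ≤ 2 * D.size + (L + 1) := Finset.card_toLeft_le.trans hJ₀
  have hunp' : ∀ C : ProbCircuit (Fin m) n,
      C.size ≤ T * (D.size + 5 * (L + 1) + 3 +
        2 ^ h * (D.size + 5 * (L + 1) + 3 + 4 * (L + 1) + 19) + 1 + 3 * J₀.toLeft.card) →
      expect Q' (fun w => C.prob w.2 w.1) ≤ (2 : ℝ) ^ (-k) := fun C hC =>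
    hunp C (by exact_mod_cast hC.trans ((Nat.mul_le_mul_left _ (by omega)).trans hs))
  have hpair : ∀ v : (Fin n ⊕ Fin m) ⊕ Fin (L + 1) → Bool, (fun i => v (.inl i)) =
      pairInput (fun i => v (.inl (.inl i)), fun i => v (.inl (.inr i))) := fun v => by
    funext i
    cases i <;> rfl
  -- Adding `2 ^ L` puts the test in the upper half of `[0, 2 ^ (L + 1)]`. After division by `2 ^ L`
  -- the loss is `2 * (ε / 4) + 1 / 2 ^ L ≤ 3 * ε / 4`, and truncation uses up the remaining `ε /
  -- 4`.
  obtain ⟨Q₁, hQ₁, hg₁, h₁⟩ := exists_highEntropy_of_unpredictable hP hk hQ'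
    (F := fun w => 2 ^ L + num (D.digits L (pairInput w))) (ℓ := L + 1)
    (fun w => by rw [pow_succ]; omega)
    (fun w => by have := hNle (pairInput w); rw [pow_succ]; omega)
    (J := J₀.toLeft) (fun x x' z hx => by simp only [hJ x x' z hx])
    ((D.decides_lt_digits L).congr fun v => by rw [hpair]) (by positivity) (by linarith) hρ hh hT
    hunp'
  -- The reflected test yields a law on the other side.
  obtain ⟨Q₂, hQ₂, hg₂, h₂⟩ := exists_highEntropy_of_unpredictable hP hk hQ'
    (F := fun w => 2 ^ L + (2 ^ L - num (D.digits L (pairInput w)))) (ℓ := L + 1)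
    (fun w => by rw [pow_succ]; omega)
    (fun w => by rw [pow_succ]; omega)
    (J := J₀.toLeft) (fun x x' z hx => by simp only [hJ x x' z hx])
    ((D.decides_lt_sub_digits hNle).congr fun v => by rw [hpair]) (by positivity) (by linarith) hρ hh
    hT hunp'
  have e₁ : ∀ R ∈ stdSimplex ℝ (BitStr n × BitStr m),
      expect R (fun w => ((2 ^ L + num (D.digits L (pairInput w)) : ℕ) : ℝ)) =
        2 ^ L * expect R f + 2 ^ L := by
    intro R hR
    rw [← expect_mul_add hR]
    congr 1
    funext w
    simp only [hf]
    push_cast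
    field_simp
    ring
  have e₂ : ∀ R ∈ stdSimplex ℝ (BitStr n × BitStr m),
      expect R (fun w => ((2 ^ L + (2 ^ L - num (D.digits L (pairInput w))) : ℕ) : ℝ)) =
        -2 ^ L * expect R f + 2 * 2 ^ L := by
    intro R hR
    rw [← expect_mul_add hR]
    congr 1
    funext w
    simp only [hf]
    rw [Nat.cast_add, Nat.cast_sub (hNle _)]
    push_cast
    field_simp
    ring
  rw [e₁ _ hQ'.1, e₁ _ hQ₁.1, pow_succ] at h₁
  rw [e₂ _ hQ'.1, e₂ _ hQ₂.1, pow_succ] at h₂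
  rw [div_le_iff₀ h2L] at hL'
  have h₁' : expect Q' f ≤ expect Q₁ f + 3 * ε / 4 := by
    refine le_of_mul_le_mul_left ?_ h2L
    linarith
  have h₂' : expect Q₂ f ≤ expect Q' f + 3 * ε / 4 := by
    refine le_of_mul_le_mul_left ?_ h2L
    linarith
  rw [abs_le] at hPQ
  have hDP := hDf P hP
  have hD₁ := hDf Q₁ hQ₁.1
  have hD₂ := hDf Q₂ hQ₂.1
  refine exists_abs_expect_sub_le (by linarith) ⟨hQ₁, hg₁⟩ ⟨hQ₂, hg₂⟩ ?_ ?_ <;> linarith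

theorem UnpEntropyGE.nonneg {s : ℕ} (h : UnpEntropyGE γ s P k) : 0 ≤ γ := by
  obtain ⟨Q, _, hind, _⟩ := h
  exact (abs_nonneg _).trans (hind ⟨0, ⟨0, .nil, fun _ => .const false⟩⟩ (by
    simp [ProbCircuit.size]))

/-- Coins are free: outputting `n` of them predicts with probability `2^(-n)`. -/
theorem UnpEntropyGE.le {s : ℕ} (h : UnpEntropyGE γ s P k) : k ≤ n := by
  obtain ⟨Q, hQ, _, hunp⟩ := h
  have hS : Samples 0 fun (_ : Fin m → Bool) (y : BitStr n) =>
      𝔼 ω : Fin n → Bool, same (fun i => ω i) y :=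
    ⟨Fin n, inferInstance, inferInstance, _, computes_wires Sum.inr, fun x y => rfl⟩
  obtain ⟨C, hC, hp⟩ := hS.exists_probCircuit
  have h1 := hunp C (by exact_mod_cast hC.trans (Nat.zero_le s))
  have h2 : ∀ y : BitStr n, 𝔼 ω : Fin n → Bool, same (fun i => ω i) y = 1 / 2 ^ n := fun y => by
    rw [Fintype.expect_eq_sum_div_card]
    simp [same]
  simp only [hp, h2] at h1
  rw [expect_const hQ.1, one_div, ← Real.rpow_natCast, ← Real.rpow_neg two_pos.le,
    Real.rpow_le_rpow_left_iff one_lt_two] at h1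
  linarith

end Metric

/-! ### Circuits without gates -/

section NoGates

variable {n m : ℕ} {P : BitStr n × BitStr m → ℝ} {k γ : ℝ}

/-- The indicator of a bit. -/
def bitVal (b : Bool) : ℝ := if b then 1 else 0

/-- Unpredictable laws look like laws of high average min-entropy to tests that read one bit. -/
theorem UnpEntropyGE.exists_highEntropy_of_bits {s : ℕ}
    (hP : P ∈ stdSimplex ℝ (BitStr n × BitStr m)) (h : UnpEntropyGE γ s P k) :
    ∃ Q, (IsPairWithSameZ P Q ∧ guess Q ≤ (2 : ℝ) ^ (-k)) ∧ ∀ i : Fin n ⊕ Fin m,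
      |expect P (fun w => bitVal (pairInput w i)) - expect Q (fun w => bitVal (pairInput w i))| ≤
        γ := by
  obtain ⟨Q', hQ', hind, hunp⟩ := h
  let μ : BitStr n → ℝ := fun x => ∑ z, Q' (x, z)
  have hμ0 : ∀ x, 0 ≤ μ x := fun x => Finset.sum_nonneg fun z _ => hQ'.1.1 _
  have hμ1 : ∑ x, μ x = 1 := by
    rw [← hQ'.1.2, Fintype.sum_prod_type]
  -- `Y` is made independent of `Z`, which no test reading a single bit can notice. Constant
  -- predictors have no gates, so every atom of `μ` is at most `2^(-k)`.
  let Q : BitStr n × BitStr m → ℝ := fun w => μ w.1 * margZ P w.2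
  have hQz : ∀ z, margZ Q z = margZ P z := fun z => by
    have : margZ Q z = ∑ x, μ x * margZ P z := rfl
    rw [this, ← Finset.sum_mul, hμ1, one_mul]
  have hQ : IsPairWithSameZ P Q := by
    refine ⟨⟨fun w => mul_nonneg (hμ0 _) (margZ_nonneg hP _), ?_⟩, hQz⟩
    rw [Fintype.sum_prod_type_right, ← sum_margZ hP]
    exact Finset.sum_congr rfl fun z _ => hQz z
  have hμk : ∀ x, μ x ≤ (2 : ℝ) ^ (-k) := by
    intro x
    have h1 := hunp ⟨0, ⟨0, .nil, fun i => .const (x i)⟩⟩ (by simp [ProbCircuit.size])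
    have h2 : ∀ w : BitStr n × BitStr m, ProbCircuit.prob (⟨0, ⟨0, .nil, fun i => .const (x i)⟩⟩ :
        ProbCircuit (Fin m) n) w.2 w.1 = if x = w.1 then 1 else 0 := fun w => by
      have : ∀ y, Circuit.eval (⟨0, .nil, fun i => .const (x i)⟩ : Circuit (Fin m ⊕ Fin 0) n) y =
        x := fun y => rfl
      simp [ProbCircuit.prob, this]
    simp only [h2] at h1
    refine le_trans (le_of_eq ?_) h1
    rw [expect, Fintype.sum_prod_type]
    simp [μ]
  refine ⟨Q, ⟨hQ, ?_⟩, fun i => ?_⟩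
  · have : ∀ z, ⨆ x, Q (x, z) ≤ (2 : ℝ) ^ (-k) * margZ P z := fun z =>
      ciSup_le fun x => mul_le_mul_of_nonneg_right (hμk x) (margZ_nonneg hP z)
    refine (Finset.sum_le_sum fun z _ => this z).trans (le_of_eq ?_)
    rw [← Finset.mul_sum, sum_margZ hP, mul_one]
  · have h1 := hind ⟨0, ⟨0, .nil, fun _ => .input (.inl i)⟩⟩ (by simp [ProbCircuit.size])
    have h2 : ∀ w : BitStr n × BitStr m,
        ProbCircuit.prob (⟨0, ⟨0, .nil, fun _ => .input (.inl i)⟩⟩ :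
          ProbCircuit (Fin n ⊕ Fin m) 1) (pairInput w) (fun _ => true) =
            bitVal (pairInput w i) := fun w => by
      have : ∀ y, Circuit.eval (⟨0, .nil, fun _ => .input (.inl i)⟩ :
        Circuit ((Fin n ⊕ Fin m) ⊕ Fin 0) 1) y = fun _ => y (.inl i) := fun y => rfl
      simp [ProbCircuit.prob, this, bitVal, funext_iff]
    simp only [h2] at h1
    refine le_of_eq_of_le ?_ h1
    congr 2
    cases i with
    | inl j =>
      have h3 : ∀ R : BitStr n × BitStr m → ℝ, expect R (fun w => bitVal (pairInput w (.inl j))) =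
          ∑ x, (∑ z, R (x, z)) * bitVal (x j) := fun R => by
        rw [expect, Fintype.sum_prod_type]
        exact Finset.sum_congr rfl fun x _ => by rw [Finset.sum_mul]; rfl
      rw [h3, h3]
      refine Finset.sum_congr rfl fun x _ => ?_
      congr 1
      simp only [Q]
      rw [← Finset.mul_sum, sum_margZ hP, mul_one]
    | inr j =>
      exact (expect_fun_snd hQ fun z => bitVal (z j)).trans
        (expect_fun_snd hQ' fun z => bitVal (z j)).symm

theorem abs_expect_sub_le_of_forall_wire {Q : BitStr n × BitStr m → ℝ}
    (hP : P ∈ stdSimplex ℝ (BitStr n × BitStr m)) (hQ : Q ∈ stdSimplex ℝ (BitStr n × BitStr m))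
    (hγ : 0 ≤ γ) (H : ∀ i : Fin n ⊕ Fin m,
      |expect P (fun w => bitVal (pairInput w i)) - expect Q (fun w => bitVal (pairInput w i))| ≤ γ)
    (C : ProbCircuit (Fin n ⊕ Fin m) 1) (hC : C.size = 0) :
    |expect P (fun w => C.prob (pairInput w) fun _ => true) -
      expect Q (fun w => C.prob (pairInput w) fun _ => true)| ≤ γ := by
  obtain ⟨c, ⟨s, N, o⟩⟩ := C
  change s = 0 at hC
  subst hC
  have h1 : ∀ w : BitStr n × BitStr m, ProbCircuit.prob ⟨c, ⟨0, N, o⟩⟩ (pairInput w)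
      (fun _ => true) = (∑ ω : BitStr c, bitVal ((o 0).val (Sum.elim (pairInput w) ω)
        (N.vals (Sum.elim (pairInput w) ω)))) / 2 ^ c := fun w => by
    simp [ProbCircuit.prob, bitVal, funext_iff, Circuit.eval]
  simp only [h1]
  cases ho : o 0 with
  | const b => simp only [Wire.val, expect_const hP, expect_const hQ, sub_self, abs_zero, hγ]
  | input i =>
    cases i with
    | inl i => simpa [Wire.val] using H i
    | inr i =>
      simp only [Wire.val, Sum.elim_inr, expect_const hP, expect_const hQ, sub_self, abs_zero, hγ]
  | gate j => exact j.elim0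

/-- Adding up all the weights would only give `2 * γ`. If the leading output is constant, the other
weights add up to at most `1`. If it is an input bit, then on the all-ones input it already
contributes `1`, so the bound on the output forces all the other outputs to be constant. -/
theorem abs_expect_realVal_sub_le_of_size_eq_zero {Q : BitStr n × BitStr m → ℝ}
    (hP : P ∈ stdSimplex ℝ (BitStr n × BitStr m)) (hQ : Q ∈ stdSimplex ℝ (BitStr n × BitStr m))
    (hγ : 0 ≤ γ) (H : ∀ i : Fin n ⊕ Fin m,
      |expect P (fun w => bitVal (pairInput w i)) - expect Q (fun w => bitVal (pairInput w i))| ≤ γ)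
    {p : ℕ} (D : Circuit (Fin n ⊕ Fin m) (p + 1)) (hD : ∀ x, D.realVal x ≤ 1) (h0 : D.size = 0) :
    |expect P (fun w => D.realVal (pairInput w)) - expect Q (fun w => D.realVal (pairInput w))| ≤
      γ := by
  obtain ⟨s, N, o⟩ := D
  change s = 0 at h0
  subst h0
  let d : Fin (p + 1) → ℝ := fun i =>
    expect P (fun w => bitVal ((o i).val (pairInput w) (N.vals (pairInput w)))) -
      expect Q (fun w => bitVal ((o i).val (pairInput w) (N.vals (pairInput w))))
  have hd : ∀ i, |d i| ≤ γ := by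
    intro i
    simp only [d]
    cases o i with
    | const b => simp only [Wire.val, expect_const hP, expect_const hQ, sub_self, abs_zero, hγ]
    | input j => exact H j
    | gate j => exact j.elim0
  have hdc : ∀ i b, o i = .const b → d i = 0 := by
    intro i b hb
    simp only [d, hb, Wire.val, expect_const hP, expect_const hQ, sub_self]
  have hr : ∀ x, Circuit.realVal ⟨0, N, o⟩ x =
      ∑ i : Fin (p + 1), (1 / 2 : ℝ) ^ (i : ℕ) * bitVal ((o i).val x (N.vals x)) := fun x =>
    Finset.sum_congr rfl fun i _ => by simp [bitVal, Circuit.eval]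
  have hsum : expect P (fun w => Circuit.realVal ⟨0, N, o⟩ (pairInput w)) -
      expect Q (fun w => Circuit.realVal ⟨0, N, o⟩ (pairInput w)) =
        ∑ i : Fin (p + 1), (1 / 2 : ℝ) ^ (i : ℕ) * d i := by
    simp only [hr, expect_sum_mul, ← Finset.sum_sub_distrib, ← mul_sub, d]
  rw [hsum, Fin.sum_univ_succ]
  have htail : ∑ i : Fin p, (1 / 2 : ℝ) ^ ((i.succ : Fin (p + 1)) : ℕ) ≤ 1 := by
    have h1 := sum_Ico_one_half_pow_le 1 (p + 1)
    rw [Finset.sum_Ico_eq_sum_range, Finset.sum_range] at h1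
    refine le_trans (le_of_eq (Finset.sum_congr rfl fun i _ => ?_)) (h1.trans (by norm_num))
    rw [Fin.val_succ, add_comm]
  cases ho : o 0 with
  | const b =>
    rw [hdc 0 b ho, mul_zero, zero_add]
    refine (Finset.abs_sum_le_sum_abs _ _).trans ?_
    have : ∀ i : Fin p, |(1 / 2 : ℝ) ^ ((i.succ : Fin (p + 1)) : ℕ) * d i.succ| ≤
        (1 / 2 : ℝ) ^ ((i.succ : Fin (p + 1)) : ℕ) * γ := fun i => by
      rw [abs_mul, abs_of_nonneg (by positivity)]
      exact mul_le_mul_of_nonneg_left (hd _) (by positivity)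
    refine (Finset.sum_le_sum fun i _ => this i).trans ?_
    rw [← Finset.sum_mul]
    exact mul_le_of_le_one_left hγ htail
  | input j =>
    have h1 := hD fun _ => true
    rw [hr, Fin.sum_univ_succ, ho] at h1
    have h2 : ∀ i : Fin p, 0 ≤ (1 / 2 : ℝ) ^ ((i.succ : Fin (p + 1)) : ℕ) *
        bitVal ((o i.succ).val (fun _ => true) (N.vals fun _ => true)) := fun i => by
      unfold bitVal
      split <;> positivity
    have h3 : ∀ i : Fin p, d i.succ = 0 := by
      intro i
      have h4 : (1 / 2 : ℝ) ^ ((i.succ : Fin (p + 1)) : ℕ) *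
          bitVal ((o i.succ).val (fun _ => true) (N.vals fun _ => true)) = 0 := by
        refine (Finset.sum_eq_zero_iff_of_nonneg fun i _ => h2 i).1 (le_antisymm ?_
          (Finset.sum_nonneg fun i _ => h2 i)) i (Finset.mem_univ i)
        simp only [Wire.val, bitVal, if_true, Fin.val_zero, pow_zero, mul_one] at h1 ⊢
        linarith
      cases hi : o i.succ with
      | const b => exact hdc _ b hi
      | input j => simp [hi, Wire.val, bitVal] at h4
      | gate j => exact j.elim0
    simpa [h3] using hd 0
  | gate j => exact j.elim0

end NoGates

/-! ### From metric entropy to HILL entropy -/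

section HILL

variable {n m : ℕ} {P : BitStr n × BitStr m → ℝ} {k : ℝ}

theorem exists_two_pow_mem_Icc {a : ℝ} (ha : 1 ≤ a) :
    ∃ h : ℕ, a ≤ 2 ^ h ∧ (2 : ℝ) ^ h ≤ 2 * a := by
  obtain ⟨j, h1, h2⟩ := exists_nat_pow_near ha one_lt_two
  refine ⟨j + 1, h2.le, ?_⟩
  rw [pow_succ]
  linarith

/-- If a randomized test distinguishes two laws, then so does a deterministic one. -/
theorem exists_decides_of_lt_abs {Q : BitStr n × BitStr m → ℝ} {η : ℝ}
    (hP : P ∈ stdSimplex ℝ (BitStr n × BitStr m)) (hQ : Q ∈ stdSimplex ℝ (BitStr n × BitStr m))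
    (C : ProbCircuit (Fin n ⊕ Fin m) 1)
    (hC : η < |expect P (fun w => C.prob (pairInput w) fun _ => true) -
      expect Q (fun w => C.prob (pairInput w) fun _ => true)|) :
    ∃ b : (Fin n ⊕ Fin m → Bool) → Bool, Decides (C.size + 1) b ∧
      η < expect P (fun w => ((b (pairInput w)).toNat : ℝ)) -
        expect Q (fun w => ((b (pairInput w)).toNat : ℝ)) := by
  let b : BitStr C.coins → (Fin n ⊕ Fin m → Bool) → Bool := fun ω x =>
    C.circuit.eval (Sum.elim x ω) 0
  have hb : ∀ ω, Decides C.size (b ω) := by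
    intro ω
    have h1 : Decides C.size fun v : (Fin n ⊕ Fin m) ⊕ Fin C.coins → Bool => C.circuit.eval v 0 :=
      ⟨C.circuit.size, C.circuit.gates, fun _ => C.circuit.out 0, le_rfl, fun _ _ => rfl⟩
    have h2 : Computes 0 fun x : Fin n ⊕ Fin m → Bool =>
        (Sum.elim x ω : (Fin n ⊕ Fin m) ⊕ Fin C.coins → Bool) :=
      ⟨0, .nil, Sum.elim .input fun i => .const (ω i), le_rfl, fun x i => by cases i <;> rfl⟩
    exact (h1.comp h2).mono (by omega)
  have hp : ∀ x, C.prob x (fun _ => true) = ∑ ω, 1 / 2 ^ C.coins * ((b ω x).toNat : ℝ) := by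
    intro x
    rw [ProbCircuit.prob, ← Finset.mul_sum, div_eq_inv_mul, one_div]
    congr 1
    refine Finset.sum_congr rfl fun ω _ => ?_
    have h1 : C.circuit.eval (Sum.elim x ω) = (fun _ => true) ↔ b ω x = true :=
      ⟨fun h => congrFun h 0, fun h => funext fun i => by rw [Subsingleton.elim i 0]; exact h⟩
    by_cases h : b ω x = true
    · rw [if_pos (h1.2 h), h]; simp
    · rw [if_neg (mt h1.1 h), Bool.eq_false_of_not_eq_true h]; simp
  let d : BitStr C.coins → ℝ := fun ω => expect P (fun w => ((b ω (pairInput w)).toNat : ℝ)) -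
    expect Q (fun w => ((b ω (pairInput w)).toNat : ℝ))
  have hd : expect P (fun w => C.prob (pairInput w) fun _ => true) -
      expect Q (fun w => C.prob (pairInput w) fun _ => true) = ∑ ω, 1 / 2 ^ C.coins * d ω := by
    simp only [hp, expect_sum_mul, ← Finset.sum_sub_distrib, ← mul_sub, d]
  rw [hd] at hC
  -- Some fixed choice of the coins does at least as well as the average; an advantage of the wrong
  -- sign is repaired by one negation gate.
  have key : ∀ e : BitStr C.coins → ℝ, η < ∑ ω, 1 / 2 ^ C.coins * e ω → ∃ ω, η < e ω := by
    intro e he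
    by_contra! hcon
    refine he.not_ge ((Finset.sum_le_sum fun ω _ =>
      mul_le_mul_of_nonneg_left (hcon ω) (by positivity)).trans (le_of_eq ?_))
    simp
  rcases lt_abs.1 hC with h | h
  · obtain ⟨ω, hω⟩ := key d h
    exact ⟨b ω, (hb ω).mono (by omega), hω⟩
  · rw [← Finset.sum_neg_distrib] at h
    obtain ⟨ω, hω⟩ := key (fun ω => -d ω) (by simpa only [mul_neg] using h)
    refine ⟨fun x => !b ω x, (hb ω).not, hω.trans_eq ?_⟩
    have hnot : ∀ R ∈ stdSimplex ℝ (BitStr n × BitStr m),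
        expect R (fun w => ((!b ω (pairInput w)).toNat : ℝ)) =
          -1 * expect R (fun w => ((b ω (pairInput w)).toNat : ℝ)) + 1 := by
      intro R hR
      rw [← expect_mul_add hR]
      congr 1
      funext w
      cases b ω (pairInput w) <;> simp
    rw [hnot P hP, hnot Q hQ]
    simp only [d]
    ring

/-- The probabilistic method: for `q` independent draws from `w`, the two Chernoff bounds and a
union bound over `V` leave the expected number of deviations below one. -/
theorem exists_family_approximating {I V : Type} [Fintype I] [Fintype V] {w : I → ℝ}
    (hw : w ∈ stdSimplex ℝ I) (b : I → V → Bool) {δ : ℝ} (hδ0 : 0 ≤ δ) (hδ1 : δ ≤ 1) {q : ℕ}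
    (hq : Fintype.card V * (2 * Real.exp (-(q * δ ^ 2 / 4))) < 1) :
    ∃ i : Fin q → I, ∀ v, |∑ j, ((b (i j) v).toNat : ℝ) - q * ∑ a, w a * (b a v).toNat| ≤
      q * δ := by
  classical
  let M : V → ℝ := fun v => ∑ a, w a * (b a v).toNat
  let bad : (Fin q → I) → V → ℝ := fun i v =>
    (if q * (M v + δ) ≤ ∑ j, ((b (i j) v).toNat : ℝ) then 1 else 0) +
      if ∑ j, ((b (i j) v).toNat : ℝ) ≤ q * (M v - δ) then 1 else 0
  have hw1 : ∑ i : Fin q → I, ∏ j, w (i j) = 1 := by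
    rw [← Fintype.piFinset_univ, ← Finset.prod_univ_sum (fun _ => Finset.univ) fun _ a => w a]
    simp [hw.2]
  have hbad : ∀ v, ∑ i : Fin q → I, (∏ j, w (i j)) * bad i v ≤
      2 * Real.exp (-(q * δ ^ 2 / 4)) := by
    intro v
    have h1 := chernoff_upper (K := Fin q) hw (f := fun a => ((b a v).toNat : ℝ))
      (fun a => Nat.cast_nonneg _) (fun a => toNat_le_one _) hδ0 hδ1
    have h2 := chernoff_lower (K := Fin q) hw (f := fun a => ((b a v).toNat : ℝ))
      (fun a => Nat.cast_nonneg _) (fun a => toNat_le_one _) hδ0 hδ1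
    rw [Fintype.card_fin] at h1 h2
    simp only [bad, mul_add, Finset.sum_add_distrib] at h1 h2 ⊢
    linarith
  have hsum : ∑ i : Fin q → I, (∏ j, w (i j)) * ∑ v, bad i v < ∑ i : Fin q → I, ∏ j, w (i j) := by
    simp_rw [hw1, Finset.mul_sum]
    rw [Finset.sum_comm]
    refine ((Finset.sum_le_sum fun v _ => hbad v).trans (le_of_eq ?_)).trans_lt hq
    rw [Finset.sum_const, Finset.card_univ, nsmul_eq_mul]
  obtain ⟨i, -, hi⟩ := Finset.exists_lt_of_sum_lt hsum
  have hwi : 0 ≤ ∏ j, w (i j) := Finset.prod_nonneg fun j _ => hw.1 _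
  have hi1 : ∑ v, bad i v < 1 := by
    by_contra! h
    exact hi.not_ge (le_mul_of_one_le_right hwi h)
  have hb0 : ∀ v, 0 ≤ bad i v := fun v => by
    simp only [bad]
    split_ifs <;> norm_num
  refine ⟨i, fun v => ?_⟩
  have hv : bad i v < 1 :=
    (Finset.single_le_sum (fun v _ => hb0 v) (Finset.mem_univ v)).trans_lt hi1
  simp only [bad] at hv
  have h1 : ¬q * (M v + δ) ≤ ∑ j, ((b (i j) v).toNat : ℝ) := fun h => by
    rw [if_pos h] at hv
    split_ifs at hv <;> linarith
  have h2 : ¬∑ j, ((b (i j) v).toNat : ℝ) ≤ q * (M v - δ) := fun h => by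
    rw [if_pos h] at hv
    split_ifs at hv
    linarith
  rw [not_le] at h1 h2
  rw [abs_le]
  constructor <;> linarith

/-- The average of `2 ^ h` circuits with Boolean output. -/
theorem exists_circuit_average {ι : Type} {g h : ℕ} {b : Fin (2 ^ h) → (ι → Bool) → Bool}
    (hb : ∀ i, Decides g (b i)) :
    ∃ D : Circuit ι (h + 1), D.size ≤ 2 ^ h * (g + 10) ∧
      ∀ x, D.realVal x = (∑ i, ((b i x).toNat : ℝ)) / 2 ^ h := by
  obtain ⟨f, hf, H⟩ := computes_count (κ := Fin (2 ^ h)) (h := h) (Fintype.card_fin _)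
  obtain ⟨s, N, o, hs, HN⟩ := hf.comp (computes_family (2 ^ h) hb)
  -- Reading the `h + 1` digits of the count from the most significant one gives the leading digit
  -- weight `1`, so the division by `2 ^ h` is free.
  refine ⟨⟨s, N, fun i => o (Fin.rev i)⟩, hs.trans (by rw [mul_add, mul_comm 10]), fun x => ?_⟩
  have h1 : ∀ i, Circuit.eval ⟨s, N, fun i => o (Fin.rev i)⟩ x i =
      f (fun i => b i x) (Fin.rev i) := fun i => HN x (Fin.rev i)
  have h2 : (∑ i, ((b i x).toNat : ℝ)) = num (f fun i => b i x) := by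
    rw [H]
    push_cast
    rfl
  rw [h2, Circuit.realVal, num, Nat.cast_sum, Finset.sum_div, ← Equiv.sum_comp Fin.revPerm]
  refine Finset.sum_congr rfl fun i _ => ?_
  rw [h1]
  have h3 : (1 / 2 : ℝ) ^ ((Fin.revPerm i : Fin (h + 1)) : ℕ) = 2 ^ (i : ℕ) / 2 ^ h := by
    have hi : (Fin.revPerm i : ℕ) = h - i := by simp [Fin.val_rev]
    rw [hi, eq_div_iff (by positivity), one_div, inv_pow, inv_mul_eq_div,
      div_eq_iff (by positivity), ← pow_add, Nat.add_sub_cancel' (by omega)]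
  rw [h3, Fin.revPerm_apply, Fin.rev_rev]
  split_ifs <;> simp

/-- Otherwise minimax gives a mixture of small Boolean circuits with advantage at least `η + δ`
against every law of high entropy. Averaging finitely many of them changes each expectation by at
most `δ / 3`, so one real-valued circuit keeps an advantage of at least `η + δ / 3`, against metric
entropy. -/
theorem MetricEntropyDetRealGE.hill {η δ t s' : ℝ} (hP : P ∈ stdSimplex ℝ (BitStr n × BitStr m))
    (hk : k ≤ n) (hmet : MetricEntropyDetRealGE η t P k) (hδ0 : 0 < δ) (hδ1 : δ ≤ 1)
    (hnm : 1 ≤ n + m) (hs' : 1 ≤ s') (ht : 2000 * (n + m) / δ ^ 2 * s' ≤ t) :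
    HILLEntropyGE (η + δ) s' P k := by
  classical
  by_contra hcon
  simp only [HILLEntropyGE, not_exists, not_and] at hcon
  -- The extra gate allows for negating a test. The index set below consists of Boolean functions
  -- rather than circuits, hence is finite.
  let g := ⌊s'⌋₊ + 1
  let I := {b : (Fin n ⊕ Fin m → Bool) → Bool // Decides g b}
  let a : I → BitStr n × BitStr m → ℝ := fun b w => ((b.1 (pairInput w)).toNat : ℝ)
  have hU := isPairWithSameZ_uniformPair hP
  have hUg : guess (uniformPair P) ≤ (2 : ℝ) ^ (-k) :=
    (guess_uniformPair hP).trans_le (one_div_two_pow_le hk)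
  let K : Set (BitStr n × BitStr m → ℝ) := {Q | IsPairWithSameZ P Q ∧ guess Q ≤ (2 : ℝ) ^ (-k)}
  have hKc : Convex ℝ K := by
    intro Q hQ Q' hQ' r s hr hs hrs
    refine ⟨convex_isPairWithSameZ P hQ.1 hQ'.1 hr hs hrs,
      (convexOn_guess.2 (Set.mem_univ _) (Set.mem_univ _) hr hs hrs).trans ?_⟩
    have h1 := mul_le_mul_of_nonneg_left hQ.2 hr
    have h2 := mul_le_mul_of_nonneg_left hQ'.2 hs
    have h3 : (r + s) * (2 : ℝ) ^ (-k) = (2 : ℝ) ^ (-k) := by rw [hrs, one_mul]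
    simp only [smul_eq_mul]
    linarith
  obtain ⟨w, hw, H⟩ := exists_nonneg_convex_combination (K := K)
    (f := fun (b : I) Q => expect P (a b) - expect Q (a b) - (η + δ)) ⟨_, hU, hUg⟩
    (fun b => ⟨hKc, fun Q _ Q' _ r s _ _ hrs => by
      simp only [expect_linear, smul_eq_mul]
      have h3 : (r + s) * (expect P (a b) - (η + δ)) = expect P (a b) - (η + δ) := by
        rw [hrs, one_mul]
      linarith⟩)
    (fun Q hQ => by
      have h1 := hcon Q hQ.1 ((le_avgMinEntropy_iff hQ.1.1).2 hQ.2)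
      simp only [Indist, not_forall, not_le] at h1
      obtain ⟨C, hC, h2⟩ := h1
      obtain ⟨b, hb, h3⟩ := exists_decides_of_lt_abs hP hQ.1.1 C h2
      refine ⟨⟨b, hb.mono (Nat.add_le_add_right (Nat.le_floor hC) 1)⟩, ?_⟩
      change 0 ≤ expect P (fun w => ((b (pairInput w)).toNat : ℝ)) -
        expect Q (fun w => ((b (pairInput w)).toNat : ℝ)) - (η + δ)
      linarith)
  have hnm' : (1 : ℝ) ≤ n + m := by exact_mod_cast hnm
  have hδ2 : 0 < δ ^ 2 := by positivity
  have hδ21 : δ ^ 2 ≤ 1 := pow_le_one₀ hδ0.le hδ1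
  -- With deviation `δ / 3` the Chernoff exponent is at least `73 * (n + m) / 36`, which exceeds `n
  -- + m + 1`; this beats the union bound over `2 ^ (n + m)` inputs.
  obtain ⟨h, hh1, hh2⟩ := exists_two_pow_mem_Icc (a := 73 * (n + m) / δ ^ 2) (by
    rw [le_div_iff₀ hδ2]; linarith)
  have hq0 : (0 : ℝ) < 2 ^ h := by positivity
  obtain ⟨i, hi⟩ := exists_family_approximating (V := Fin n ⊕ Fin m → Bool) hw (fun b v => b.1 v)
    (δ := δ / 3) (by linarith) (by linarith) (q := 2 ^ h) (by
      have h1 : (2 : ℝ) ^ (n + m) * 2 < Real.exp (2 ^ h * (δ / 3) ^ 2 / 4) := by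
        have h2 : (2 : ℝ) ^ (n + m) * 2 ≤ Real.exp (n + m + 1) := by
          rw [← pow_succ]
          refine (pow_le_pow_left₀ two_pos.le (Real.exp_one_gt_d9.le.trans' (by norm_num))
            _).trans (le_of_eq ?_)
          rw [← Real.exp_nat_mul]
          push_cast
          ring_nf
        refine h2.trans_lt (Real.exp_lt_exp.2 ?_)
        rw [div_le_iff₀ hδ2] at hh1
        linarith
      rw [Real.exp_neg, ← div_eq_mul_inv, ← mul_div_assoc, div_lt_one (Real.exp_pos _)]
      simpa using h1)
  obtain ⟨D, hDs, hD⟩ := exists_circuit_average fun j => (i j).2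
  have hD1 : ∀ x, D.realVal x ≤ 1 := fun x => by
    rw [hD, div_le_one hq0]
    refine (Finset.sum_le_sum fun j _ => toNat_le_one _).trans (le_of_eq ?_)
    simp
  have hDt : (D.size : ℝ) ≤ t := by
    refine le_trans ?_ ht
    have h1 : (D.size : ℝ) ≤ 2 ^ h * (g + 10) := by exact_mod_cast hDs
    have h2 : (g : ℝ) ≤ s' + 1 := by
      have := Nat.floor_le (zero_le_one.trans hs')
      simp only [g]
      push_cast
      linarith
    have h3 : (2 : ℝ) ^ h * (g + 10) ≤ 2 * (73 * (n + m) / δ ^ 2) * (12 * s') :=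
      mul_le_mul hh2 (by linarith) (by positivity) (by positivity)
    refine h1.trans (h3.trans ?_)
    have h4 : 0 ≤ (n + m) / δ ^ 2 * s' := by positivity
    have h5 : 2 * (73 * (n + m) / δ ^ 2) * (12 * s') = 1752 * ((n + m) / δ ^ 2 * s') := by ring
    have h6 : 2000 * (n + m) / δ ^ 2 * s' = 2000 * ((n + m) / δ ^ 2 * s') := by ring
    rw [h5, h6]
    linarith
  obtain ⟨Q, hQ, hQk, hQD⟩ := hmet h D hD1 hDt
  have hQ1 := H Q ⟨hQ, (le_avgMinEntropy_iff hQ.1).1 hQk⟩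
  have hap : ∀ v, |D.realVal v - ∑ b, w b * ((b.1 v).toNat : ℝ)| ≤ δ / 3 := by
    intro v
    have h1 := hi v
    push_cast at h1
    have h2 : D.realVal v - ∑ b, w b * ((b.1 v).toNat : ℝ) =
        (∑ j, (((i j).1 v).toNat : ℝ) - 2 ^ h * ∑ b, w b * ((b.1 v).toNat : ℝ)) / 2 ^ h := by
      rw [hD]
      field_simp
    rw [h2, abs_div, abs_of_pos hq0, div_le_iff₀' hq0]
    exact h1
  have hE : ∀ R ∈ stdSimplex ℝ (BitStr n × BitStr m),
      ∑ b, w b * expect R (a b) - δ / 3 ≤ expect R (fun w => D.realVal (pairInput w)) ∧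
        expect R (fun w => D.realVal (pairInput w)) ≤ ∑ b, w b * expect R (a b) + δ / 3 := by
    intro R hR
    have h1 := expect_mul_add hR (fun v => ∑ b, w b * a b v) 1 (δ / 3)
    have h2 := expect_mul_add hR (fun v => ∑ b, w b * a b v) 1 (-(δ / 3))
    rw [expect_sum_mul, one_mul] at h1 h2
    rw [sub_eq_add_neg, ← h1, ← h2]
    refine ⟨expect_mono hR fun v => ?_, expect_mono hR fun v => ?_⟩ <;>
    · have := abs_le.1 (hap (pairInput v))
      simp only [a]
      linarith
  have hsum : ∑ b, w b * (expect P (a b) - expect Q (a b) - (η + δ)) =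
      ∑ b, w b * expect P (a b) - ∑ b, w b * expect Q (a b) - (η + δ) := by
    simp only [mul_sub, Finset.sum_sub_distrib, ← Finset.sum_mul, hw.2, one_mul]
  rw [hsum] at hQ1
  have h1 := (abs_le.1 hQD).2
  have h2 := (hE P hP).1
  have h3 := (hE Q hQ.1).2
  linarith

end HILL

/-! ### The quantitative statements -/

section Final

variable {n m s : ℕ} {P : BitStr n × BitStr m → ℝ} {k γ ε : ℝ}

theorem expect_mem_Icc {Q f : BitStr n × BitStr m → ℝ}
    (hQ : Q ∈ stdSimplex ℝ (BitStr n × BitStr m)) (h0 : ∀ w, 0 ≤ f w) (h1 : ∀ w, f w ≤ 1) :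
    0 ≤ expect Q f ∧ expect Q f ≤ 1 :=
  ⟨(expect_const hQ 0).symm.trans_le (expect_mono hQ h0),
    (expect_mono hQ h1).trans_eq (expect_const hQ 1)⟩

theorem abs_expect_sub_expect_le_one {Q f : BitStr n × BitStr m → ℝ}
    (hP : P ∈ stdSimplex ℝ (BitStr n × BitStr m)) (hQ : Q ∈ stdSimplex ℝ (BitStr n × BitStr m))
    (h0 : ∀ w, 0 ≤ f w) (h1 : ∀ w, f w ≤ 1) : |expect P f - expect Q f| ≤ 1 := by
  have h2 := expect_mem_Icc hP h0 h1
  have h3 := expect_mem_Icc hQ h0 h1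
  exact abs_le.2 ⟨by linarith, by linarith⟩

theorem Circuit.realVal_nonneg {ι : Type} {p : ℕ} (D : Circuit ι (p + 1)) (x : ι → Bool) :
    0 ≤ D.realVal x :=
  Finset.sum_nonneg fun i _ => by split <;> positivity

theorem ProbCircuit.prob_nonneg {ι : Type} {o : ℕ} (C : ProbCircuit ι o) (x : ι → Bool)
    (y : BitStr o) : 0 ≤ C.prob x y :=
  div_nonneg (Finset.sum_nonneg fun i _ => by split <;> norm_num) (by positivity)

theorem ProbCircuit.prob_le_one {ι : Type} {o : ℕ} (C : ProbCircuit ι o) (x : ι → Bool)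
    (y : BitStr o) : C.prob x y ≤ 1 := by
  rw [ProbCircuit.prob, div_le_one (by positivity)]
  refine (Finset.sum_le_sum fun ω _ => show _ ≤ (1 : ℝ) by split <;> norm_num).trans (le_of_eq ?_)
  simp

/-- The number of gates of the predictor. -/
theorem predictor_size_le {d l t R T N : ℝ} (hd0 : 0 ≤ d) (hl0 : 0 ≤ l) (hN0 : 0 ≤ N) (ht : 1 ≤ t)
    (hR : 1 ≤ R) (hd : d ≤ t) (hl : l ≤ 8 * R) (hT : T ≤ 9 * R) (hN : N ≤ 2 ^ 20 * R ^ 3) :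
    T * (d + 5 * l + 3 + N * (d + 5 * l + 3 + 4 * l + 19) + 1 + 3 * (2 * d + l)) ≤
      2 ^ 31 * (t * R ^ 5) := by
  have htR : 1 ≤ t * R := one_le_mul_of_one_le_of_one_le ht hR
  have h1 : d ≤ t * R := hd.trans (le_mul_of_one_le_right (by linarith) hR)
  have h2 : l ≤ 8 * (t * R) := by nlinarith
  have h3 : N * (d + 5 * l + 3 + 4 * l + 19) ≤ 2 ^ 20 * R ^ 3 * (95 * (t * R)) :=
    mul_le_mul hN (by linarith) (by positivity) (by positivity)
  have h4 : t * R ≤ t * R ^ 4 :=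
    mul_le_mul_of_nonneg_left (le_self_pow₀ hR (by norm_num)) (by linarith)
  have h5 : d + 5 * l + 3 + N * (d + 5 * l + 3 + 4 * l + 19) + 1 + 3 * (2 * d + l) ≤
      2 ^ 27 * (t * R ^ 4) := by
    have : 2 ^ 20 * R ^ 3 * (95 * (t * R)) = 95 * 2 ^ 20 * (t * R ^ 4) := by ring
    rw [this] at h3
    linarith
  calc _ ≤ 9 * R * (2 ^ 27 * (t * R ^ 4)) := mul_le_mul hT h5 (by positivity) (by positivity)
    _ = 9 * 2 ^ 27 * (t * R ^ 5) := by ring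
    _ ≤ 2 ^ 31 * (t * R ^ 5) := by
      refine mul_le_mul_of_nonneg_right (by norm_num) (by positivity)

/-- With `R = 2 ^ (n - k) / ε`, the predictor makes `O(R)` attempts, each using `O(R ^ 3)` samples
of a test with `O(t * R)` gates, which accounts for `t * R ^ 5`. The uniform law settles `ε ≥ 1`,
and `t < 1` leaves only circuits without gates. -/
theorem UnpEntropyGE.metric {t : ℝ} (hP : P ∈ stdSimplex ℝ (BitStr n × BitStr m))
    (h : UnpEntropyGE γ s P k) (hε : 0 < ε) (hR2 : 2 ≤ (2 : ℝ) ^ (n - k) / ε)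
    (hs : 2 ^ 31 * (t * ((2 : ℝ) ^ (n - k) / ε) ^ 5) ≤ s) :
    MetricEntropyDetRealGE (ε + γ) t P k := by
  intro p D hD hDt
  have hγ := h.nonneg
  have hk := h.le
  suffices hQ : ∃ Q, (IsPairWithSameZ P Q ∧ guess Q ≤ (2 : ℝ) ^ (-k)) ∧
      |expect P (fun w => D.realVal (pairInput w)) -
        expect Q (fun w => D.realVal (pairInput w))| ≤ ε + γ by
    obtain ⟨Q, ⟨hQ, hg⟩, hd⟩ := hQ
    exact ⟨Q, hQ, (le_avgMinEntropy_iff hQ.1).2 hg, hd⟩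
  rcases le_or_gt 1 ε with hε1 | hε1
  · have hU := isPairWithSameZ_uniformPair hP
    refine ⟨_, ⟨hU, (guess_uniformPair hP).trans_le (one_div_two_pow_le hk)⟩, ?_⟩
    exact (abs_expect_sub_expect_le_one hP hU.1 (fun w => D.realVal_nonneg _)
      fun w => hD _).trans (by linarith)
  rcases lt_or_ge t 1 with ht | ht
  · have h0 : D.size = 0 := by
      have : (D.size : ℝ) < 1 := hDt.trans_lt ht
      have : D.size < 1 := by exact_mod_cast this
      omega
    obtain ⟨Q, hQ, H⟩ := h.exists_highEntropy_of_bits hP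
    exact ⟨Q, hQ, (abs_expect_realVal_sub_le_of_size_eq_zero hP hQ.1.1 hγ H D hD h0).trans
      (by linarith)⟩
  set E := (2 : ℝ) ^ (n - k) with hE
  have hE1 : 1 ≤ E := Real.one_le_rpow one_le_two (by linarith)
  set R := E / ε with hR
  have hRε : 1 / ε ≤ R := div_le_div_of_nonneg_right hE1 hε.le
  obtain ⟨L, hL1, hL2⟩ := exists_two_pow_mem_Icc (a := 4 / ε) (by
    rw [le_div_iff₀ hε]; linarith)
  have hl : ((L + 1 : ℕ) : ℝ) ≤ 8 * R := by
    have h1 : ((L + 1 : ℕ) : ℝ) ≤ 2 ^ L := by exact_mod_cast Nat.lt_two_pow_self (n := L)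
    have h2 : 2 * (4 / ε) = 8 * (1 / ε) := by ring
    linarith
  -- Since `ρ = 1 / (32 * R)`, this makes the Chernoff exponent at least `32 * R`, and the crude
  -- bound `exp (-x) ≤ 1 / x` suffices for an error of `ρ`.
  obtain ⟨h', hh1, hh2⟩ := exists_two_pow_mem_Icc (a := 2 ^ 19 * R ^ 3) (by
    have : 1 ≤ R ^ 3 := one_le_pow₀ (by linarith)
    linarith)
  obtain ⟨Q', hQ', hind, hunp⟩ := h
  have hρ : ε / 4 / (8 * E) = 1 / (32 * R) := by
    rw [hR]
    field_simp
    norm_num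
  have hsize := predictor_size_le (d := D.size) (l := (L + 1 : ℕ)) (t := t) (R := R)
    (T := (⌊8 * R⌋₊ + 1 : ℕ)) (N := 2 ^ h') (by positivity) (by positivity) (by positivity) ht
    (by linarith) hDt hl (by
      have := Nat.floor_le (show 0 ≤ 8 * R by linarith)
      push_cast
      linarith) (hh2.trans (by linarith))
  refine exists_highEntropy_of_realVal hP hk hγ hQ' D hD hε hε1.le rfl (h := h')
    (T := ⌊8 * R⌋₊ + 1) (L := L) ?_ ?_ hL1 ?_ ?_ hind hunp
  · rw [hρ]
    have hx : 32 * R ≤ 2 ^ h' * (1 / (32 * R) / 2) ^ 2 / 4 := by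
      have h1 : 2 ^ 19 * R ^ 3 * (1 / (32 * R) / 2) ^ 2 / 4 = 32 * R := by
        field_simp
        norm_num
      refine h1.symm.le.trans ?_
      gcongr
    rw [Real.exp_neg, ← one_div]
    exact one_div_le_one_div_of_le (by linarith) (hx.trans ((Real.add_one_le_exp _).trans' (by linarith)))
  · have : 2 * E / (ε / 4) = 8 * R := by
      rw [hR]
      field_simp
      norm_num
    rw [this]
    exact_mod_cast Nat.lt_floor_add_one (8 * R)
  · have := hsize.trans hs
    exact_mod_cast this
  · have h1 : (D.size : ℝ) + 4 * ((L + 1 : ℕ) : ℝ) ≤ s := by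
      refine le_trans ?_ hs
      have htR : t * R ≤ t * R ^ 5 :=
        mul_le_mul_of_nonneg_left (le_self_pow₀ (by linarith) (by norm_num)) (by linarith)
      have h2 : t ≤ t * R := le_mul_of_one_le_right (by linarith) (by linarith)
      have h3 : R ≤ t * R := le_mul_of_one_le_left (by linarith) ht
      linarith
    exact_mod_cast h1

theorem UnpEntropyGE.hill {t δ : ℝ} (hP : P ∈ stdSimplex ℝ (BitStr n × BitStr m))
    (h : UnpEntropyGE γ s P k) (hε : 0 < ε) (hmet : MetricEntropyDetRealGE (ε + γ) t P k)
    (hδ : 0 < δ) : HILLEntropyGE (ε + δ + γ) (1 / 2000 * (t * δ ^ 2 / (n + m))) P k := by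
  have hγ := h.nonneg
  have hk := h.le
  rcases le_or_gt 1 δ with hδ1 | hδ1
  · have hU := isPairWithSameZ_uniformPair hP
    refine ⟨_, hU, (le_avgMinEntropy_iff hU.1).2
      ((guess_uniformPair hP).trans_le (one_div_two_pow_le hk)), fun C _ => ?_⟩
    exact (abs_expect_sub_expect_le_one hP hU.1 (fun w => C.prob_nonneg _ _)
      fun w => C.prob_le_one _ _).trans (by linarith)
  set s' := 1 / 2000 * (t * δ ^ 2 / (n + m)) with hs'
  rcases lt_or_ge s' 1 with h1 | h1
  · obtain ⟨Q, hQ, H⟩ := h.exists_highEntropy_of_bits hP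
    refine ⟨Q, hQ.1, (le_avgMinEntropy_iff hQ.1.1).2 hQ.2, fun C hC => ?_⟩
    have h0 : C.size = 0 := by
      have : (C.size : ℝ) < 1 := hC.trans_lt h1
      have : C.size < 1 := by exact_mod_cast this
      omega
    exact (abs_expect_sub_le_of_forall_wire hP hQ.1.1 hγ H C h0).trans (by linarith)
  · have hnm : 1 ≤ n + m := by
      -- For `n = m = 0` the division by zero makes `s'` equal to `0`, contrary to `1 ≤ s'`.
      by_contra! h0
      have h2 : n = 0 ∧ m = 0 := by omega
      rw [hs', h2.1, h2.2] at h1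
      norm_num at h1
    have hnm' : (0 : ℝ) < n + m := by
      have : (1 : ℝ) ≤ n + m := by exact_mod_cast hnm
      linarith
    rw [add_right_comm]
    refine hmet.hill hP hk hδ hδ1.le hnm h1 (le_of_eq ?_)
    rw [hs']
    field_simp

end Final

end CompEntropy

theorem theorem2 :
    ∃ c₁ : ℝ, 0 < c₁ ∧ ∃ c₂ : ℝ, 0 < c₂ ∧ ∃ c₃ : ℝ, 0 < c₃ ∧
      ∀ (n m s : ℕ) (k γ ε Δ t : ℝ) (P : CompEntropy.BitStr n × CompEntropy.BitStr m → ℝ),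
        P ∈ stdSimplex ℝ (CompEntropy.BitStr n × CompEntropy.BitStr m) →
        CompEntropy.UnpEntropyGE γ s P k →
        Δ = n - k →
        0 < ε →
        2 ≤ (2 : ℝ) ^ Δ / ε →
        t = c₁ * (s * (ε ^ 5 / ((2 : ℝ) ^ (5 * Δ) * Real.logb 2 ((2 : ℝ) ^ Δ / ε) ^ 2))) →
        CompEntropy.MetricEntropyDetRealGE (ε + γ) t P k ∧
        (∀ δ : ℝ, 0 < δ →
          CompEntropy.HILLEntropyGE (ε + δ + γ) (c₂ * (t * δ ^ 2 / (n + m))) P k) ∧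
        (γ = ε →
          CompEntropy.HILLEntropyGE (3 * ε)
            (c₃ * (s * ε ^ 7 /
              ((2 : ℝ) ^ (5 * Δ) * (n + m) * Real.logb 2 ((2 : ℝ) ^ Δ / ε) ^ 2))) P k) := by
  refine ⟨1 / 2 ^ 31, by positivity, 1 / 2000, by positivity, 1 / 2 ^ 31 * (1 / 2000),
    by positivity, ?_⟩
  intro n m s k γ ε Δ t P hP h hΔ hε hR ht
  subst hΔ
  have hE5 : (2 : ℝ) ^ (5 * ((n : ℝ) - k)) = ((2 : ℝ) ^ ((n : ℝ) - k)) ^ 5 := by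
    rw [mul_comm, ← Real.rpow_natCast, ← Real.rpow_mul two_pos.le]
    norm_num
  have hlog : 1 ≤ Real.logb 2 ((2 : ℝ) ^ ((n : ℝ) - k) / ε) := by
    rw [Real.le_logb_iff_rpow_le one_lt_two (by linarith), Real.rpow_one]
    exact hR
  have hE0 : (0 : ℝ) < 2 ^ ((n : ℝ) - k) := by positivity
  have hs : 2 ^ 31 * (t * ((2 : ℝ) ^ ((n : ℝ) - k) / ε) ^ 5) ≤ s := by
    have h1 : 2 ^ 31 * (t * ((2 : ℝ) ^ ((n : ℝ) - k) / ε) ^ 5) =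
        s / Real.logb 2 ((2 : ℝ) ^ ((n : ℝ) - k) / ε) ^ 2 := by
      rw [ht, hE5]
      generalize Real.logb 2 ((2 : ℝ) ^ ((n : ℝ) - k) / ε) = l at hlog
      have hl : 0 < l := by linarith
      field_simp
    rw [h1]
    -- The squared logarithm is at least `1` and is discarded: the predictor fits without it.
    exact div_le_self (Nat.cast_nonneg s) (one_le_pow₀ hlog)
  have hmet := h.metric hP hε hR hs
  refine ⟨hmet, fun δ hδ => h.hill hP hε hmet hδ, fun hγ => ?_⟩
  have h3 := h.hill hP hε hmet hε
  rw [hγ] at h3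
  convert h3 using 1
  · ring
  · rw [ht]
    generalize Real.logb 2 ((2 : ℝ) ^ ((n : ℝ) - k) / ε) = l
    generalize (2 : ℝ) ^ (5 * ((n : ℝ) - k)) = e
    simp only [div_eq_mul_inv, mul_inv]
    ring
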